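/- Theorem 2. Let $L$ be a context-free language that does not contain the empty string $\varepsilon$. Then there is a Graph Interpolation Grammar $G$ (over the same alphabet) that recognizes exactly $L$. Definitions. A *parse graph* over a set $V$ of variables and a set $\Sigma$ of symbols is a finite rooted graph $\Gamma=\langle N,L,r,\gamma,E,F\rangle$ representing a tree: $N$ (nonlexical nodes, labelled in $V$) and $L$ (lexemes, labelled in $\Sigma$) are disjoint, $\gamma$ is the labelling, $r\in N$ is the root; $E\subseteq N\times(N\cup L)$ (first-child edges) and $F\subseteq N\times N$ (right-sibling edges) are disjoint partial functions; $r$ has no incoming edge, every other node has exactly one incoming $E\cup F$-edge, and every node is reachable from $r$. A node is *terminal* if it has no $E$-edge. The *successor* relation on nodes is $<\;=((F^{-1})^*\circ E^{-1})^*\circ F\circ E^*$ (composition read from left to right), and $m\ll n$ means that $m<n$ and that $m<p<n$ only for $p=m$ or $p=n$. The *frontier* of $\Gamma$ is the list of all its terminal nodes, each once, in $\ll$-order; its *yield* is the string of labels along the frontier. Let $\Gamma_1,\Gamma_2$ be node-disjoint parse graphs, let $\Gamma_2$ have exactly one lexeme, let $s$ be the root of $\Gamma_2$, $q\in N_1$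 (the *anchor*), and $t$ a node of $\Gamma_2$ (the *target*). The *interpolation* $\mathcal I(\Gamma_1,\Gamma_2,q,t)=\Gamma_3$ is obtained from the union of the two graphs by deleting $q$; making $s$ the root if $q$ was the root of $\Gamma_1$ (otherwise keeping the root of $\Gamma_1$); redirecting to $s$ the edge entering $q$, if any; making the first child of $q$, if any, the first child of $t$ if the path from $s$ to $t$ begins with an $E$-edge (down-shift), and of $s$ otherwise; and making the right sibling of $q$, if any, the right sibling of $t$ if that path begins with an $F$-edge (right-shift), and of $s$ otherwise. ($t=s$ is an $\epsilon$-shift.) It is defined only if the result $\Gamma_3$ is a parse graph, the frontier of $\Gamma_1$ has the form $x\alpha$ with $x\in L_1^*$, $\alpha\in N_1^*$, and, $a$ being the lexeme of $\Gamma_2$, the frontier of $\Gamma_3$ has prefix $xa$. A *Graph Interpolation Grammar* over $\Sigma$ is a tuple $\langle V,\Sigma,P,S\rangle$ with $V$ a finite set of variables, $S\in V$, and $P$ a finite set of rules $\langle A,\Gamma_2,t\rangle$, where $A\in V$, $\Gamma_2$ is a parse graph and $t$ is a node of $\Gamma_2$. Its instantaneous descriptions are pairs $\langle\Gamma,u\rangle$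 of a parse graph and a remaining input $u\in\Sigma^*$. There is a move $\langle\Gamma,ax\rangle\to\langle\Gamma_3,x\rangle$, $a\in\Sigma$, if for some rule $\langle A,\Gamma_2,t\rangle\in P$ and some node $q$ of $\Gamma$ labelled $A$, $\Gamma_3=\mathcal I(\Gamma,\Gamma_2',q,t')$, where $\Gamma_2'$ is a copy of $\Gamma_2$ with fresh nodes and $t'$ is the copy of $t$, and the string of symbols in the yield of $\Gamma_3$ is the one of $\Gamma$ followed by $a$. The grammar accepts $w\in\Sigma^*$ if some sequence of moves leads from $\langle\Gamma_0,w\rangle$, with $\Gamma_0$ a single node labelled $S$, to some $\langle\Gamma_f,\varepsilon\rangle$ such that the yield of $\Gamma_f$ is $w$ (so no variable is left in the yield). It recognizes the set of all strings that it accepts. -/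

import Mathlib

/-- A parse graph with variables in `V` and symbols in `α`: a finite tree in which each node points
to its first child (`E`) and to its right sibling (`F`).  Nodes are taken in the infinite set `ℕ`.
The function `label` is meaningful on nodes only. -/
structure ParseGraph (V : Type*) (α : Type*) where
  /-- nonlexical nodes -/
  N : Finset ℕ
  /-- lexemes -/
  L : Finset ℕ
  /-- the root -/
  root : ℕ
  /-- label assignment -/
  label : ℕ → V ⊕ α
  /-- first-child edges -/
  E : ℕ → ℕ → Prop
  /-- right-sibling edges -/
  F : ℕ → ℕ → Prop
  disjoint : Disjoint N L
  root_mem : root ∈ N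
  label_N : ∀ n ∈ N, ∃ A, label n = Sum.inl A
  label_L : ∀ n ∈ L, ∃ a, label n = Sum.inr a
  E_mem : ∀ m n, E m n → m ∈ N ∧ n ∈ N ∪ L
  F_mem : ∀ m n, F m n → m ∈ N ∧ n ∈ N
  E_fun : ∀ m n n', E m n → E m n' → n = n'
  F_fun : ∀ m n n', F m n → F m n' → n = n'
  /-- every node except the root has exactly one immediate dominator -/
  dominator : ∀ n ∈ N ∪ L, n ≠ root → ∃! m, E m n ∨ F m n
  /-- a first child is not also a right sibling -/
  not_E_F : ∀ m n, E m n → ¬ F m n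
  /-- the root has no dominator -/
  root_top : ∀ m, ¬ E m root ∧ ¬ F m root
  /-- the graph is rooted at `root` -/
  reachable : ∀ n ∈ N ∪ L, Relation.ReflTransGen (fun x y => E x y ∨ F x y) root n

namespace ParseGraph

variable {V : Type*} {α : Type*}

/-- Some path leads from `m` to `n`. -/
def Path (Γ : ParseGraph V α) : ℕ → ℕ → Prop :=
  Relation.ReflTransGen (fun x y => Γ.E x y ∨ Γ.F x y)

/-- `(F⁻¹)* ∘ E⁻¹`: from a node to its parent in the represented tree. -/
def Up (Γ : ParseGraph V α) (n p : ℕ) : Prop :=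
  ∃ c, Relation.ReflTransGen (fun x y => Γ.F y x) n c ∧ Γ.E p c

/-- The successor relation `((F⁻¹)* ∘ E⁻¹)* ∘ F ∘ E*`. -/
def Succ (Γ : ParseGraph V α) (m n : ℕ) : Prop :=
  ∃ x y, Relation.ReflTransGen Γ.Up m x ∧ Γ.F x y ∧ Relation.ReflTransGen Γ.E y n

/-- The immediate successor relation. -/
def ImmSucc (Γ : ParseGraph V α) (m n : ℕ) : Prop :=
  Γ.Succ m n ∧ ∀ p, Γ.Succ m p → Γ.Succ p n → m = p ∨ n = p

/-- Terminal nodes: nodes without a child. -/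
def IsTerminal (Γ : ParseGraph V α) (n : ℕ) : Prop :=
  n ∈ Γ.N ∪ Γ.L ∧ ∀ m, ¬ Γ.E n m

/-- `w` is the frontier of `Γ`: the list of all and only its terminal nodes, each once, in
immediate successor order. -/
def IsFrontier (Γ : ParseGraph V α) (w : List ℕ) : Prop :=
  w.Nodup ∧ (∀ n, n ∈ w ↔ Γ.IsTerminal n) ∧ w.IsChain Γ.ImmSucc

/-- `y` is the yield of `Γ`: the string of labels along its frontier. -/
def IsYield (Γ : ParseGraph V α) (y : List (V ⊕ α)) : Prop :=
  ∃ w, Γ.IsFrontier w ∧ y = w.map Γ.label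

/-- `v` is the string of symbols in the yield of `Γ`. -/
def IsSymbolYield (Γ : ParseGraph V α) (v : List α) : Prop :=
  ∃ y, Γ.IsYield y ∧ v = y.filterMap Sum.getRight?

/-- `Γ` is a single node labelled `A`. -/
def IsSingle (Γ : ParseGraph V α) (A : V) : Prop :=
  Γ.N = {Γ.root} ∧ Γ.L = ∅ ∧ Γ.label Γ.root = Sum.inl A

/-- `f` is an isomorphism from `Γ` onto `Γ'`, i.e. `Γ'` is a copy of `Γ` with other node names. -/
structure IsCopy (f : ℕ → ℕ) (Γ Γ' : ParseGraph V α) : Prop where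
  bij_N : Set.BijOn f Γ.N Γ'.N
  bij_L : Set.BijOn f Γ.L Γ'.L
  root : f Γ.root = Γ'.root
  label : ∀ n ∈ Γ.N ∪ Γ.L, Γ'.label (f n) = Γ.label n
  E : ∀ m ∈ Γ.N ∪ Γ.L, ∀ n ∈ Γ.N ∪ Γ.L, (Γ'.E (f m) (f n) ↔ Γ.E m n)
  F : ∀ m ∈ Γ.N ∪ Γ.L, ∀ n ∈ Γ.N ∪ Γ.L, (Γ'.F (f m) (f n) ↔ Γ.F m n)

/-- The path from the root to `t` starts with a first-child edge (down-shift). -/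
def IsDownPath (Γ : ParseGraph V α) (t : ℕ) : Prop :=
  ∃ s', Γ.E Γ.root s' ∧ Γ.Path s' t

/-- The path from the root to `t` starts with a right-sibling edge (right-shift). -/
def IsRightPath (Γ : ParseGraph V α) (t : ℕ) : Prop :=
  ∃ s', Γ.F Γ.root s' ∧ Γ.Path s' t

/-- `Γ₃` is the result of the interpolation of `Γ₂` into `Γ₁` with anchor `q` and target `t`.
The interpolation is defined only if the graph described here is a parse graph. -/
structure IsInterpolation (Γ₁ Γ₂ : ParseGraph V α) (q t : ℕ) (Γ₃ : ParseGraph V α) : Prop where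
  anchor : q ∈ Γ₁.N
  target : t ∈ Γ₂.N ∪ Γ₂.L
  path : Γ₂.Path Γ₂.root t
  /-- disjunction constraint -/
  disjoint : Disjoint (Γ₁.N ∪ Γ₁.L) (Γ₂.N ∪ Γ₂.L)
  /-- lexicalization constraint -/
  lexicalized : Γ₂.L.card = 1
  N_eq : Γ₃.N = (Γ₁.N \ {q}) ∪ Γ₂.N
  L_eq : Γ₃.L = Γ₁.L ∪ Γ₂.L
  /-- the source takes the place of the anchor, also when the anchor is the root -/
  root_eq : Γ₃.root = if q = Γ₁.root then Γ₂.root else Γ₁.root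
  label_left : ∀ n ∈ (Γ₁.N \ {q}) ∪ Γ₁.L, Γ₃.label n = Γ₁.label n
  label_right : ∀ n ∈ Γ₂.N ∪ Γ₂.L, Γ₃.label n = Γ₂.label n
  E_iff : ∀ m n, Γ₃.E m n ↔
    (Γ₁.E m n ∧ m ≠ q ∧ n ≠ q) ∨ Γ₂.E m n ∨
    (Γ₁.E m q ∧ n = Γ₂.root) ∨
    (Γ₁.E q n ∧ ((Γ₂.IsDownPath t ∧ m = t) ∨ (¬ Γ₂.IsDownPath t ∧ m = Γ₂.root)))
  F_iff : ∀ m n, Γ₃.F m n ↔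
    (Γ₁.F m n ∧ m ≠ q ∧ n ≠ q) ∨ Γ₂.F m n ∨
    (Γ₁.F m q ∧ n = Γ₂.root) ∨
    (Γ₁.F q n ∧ ((Γ₂.IsRightPath t ∧ m = t) ∨ (¬ Γ₂.IsRightPath t ∧ m = Γ₂.root)))
  /-- context constraint and frontier constraint -/
  frontier : ∃ x ξ δ β w₃ : List ℕ, ∃ a : ℕ,
    Γ₁.IsFrontier (x ++ ξ) ∧ (∀ n ∈ x, n ∈ Γ₁.L) ∧ (∀ n ∈ ξ, n ∈ Γ₁.N) ∧
    Γ₂.IsFrontier (δ ++ a :: β) ∧ a ∈ Γ₂.L ∧ (∀ n ∈ δ, n ∈ Γ₂.N) ∧ (∀ n ∈ β, n ∈ Γ₂.N) ∧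
    Γ₃.IsFrontier w₃ ∧ x ++ [a] <+: w₃

end ParseGraph

/-- An interpolation rule: context pattern, addendum, interpolation target. -/
structure InterpolationRule (V : Type*) (α : Type*) where
  pattern : V
  addendum : ParseGraph V α
  target : ℕ
  target_mem : target ∈ addendum.N ∪ addendum.L

/-- A graph interpolation grammar over the alphabet `α`: a finite set `V` of variables, a finite
set of interpolation rules, and a start variable. -/
structure GraphInterpolationGrammar (α : Type*) where
  V : Type
  finite_V : Finite V
  rules : Set (InterpolationRule V α)
  finite_rules : rules.Finite
  start : V

namespace GraphInterpolationGrammar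

variable {α : Type*}

/-- An instantaneous description: a context and the input that remains to be scanned. -/
abbrev ID (G : GraphInterpolationGrammar α) : Type _ := ParseGraph G.V α × List α

/-- One move: a rule, whose addendum is given fresh node names, is applied to the context, and one
symbol of the input is scanned. -/
def Step (G : GraphInterpolationGrammar α) (I J : G.ID) : Prop :=
  ∃ a : α, I.2 = a :: J.2 ∧
    (∃ ρ ∈ G.rules, ∃ (f : ℕ → ℕ) (Γ₂ : ParseGraph G.V α) (q : ℕ),
      ParseGraph.IsCopy f ρ.addendum Γ₂ ∧
      I.1.label q = Sum.inl ρ.pattern ∧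
      ParseGraph.IsInterpolation I.1 Γ₂ q (f ρ.target) J.1) ∧
    ∃ v, I.1.IsSymbolYield v ∧ J.1.IsSymbolYield (v ++ [a])

/-- `G` accepts `w` if moves lead from the initial context with input `w` to a context whose whole
yield is `w`, with no input left. -/
def Accepts (G : GraphInterpolationGrammar α) (w : List α) : Prop :=
  ∃ Γ₀ Γf : ParseGraph G.V α, Γ₀.IsSingle G.start ∧
    Relation.ReflTransGen G.Step (Γ₀, w) (Γf, []) ∧ Γf.IsYield (w.map Sum.inr)

/-- The language recognized by `G`. -/
def language (G : GraphInterpolationGrammar α) : Language α :=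
  {w | G.Accepts w}

end GraphInterpolationGrammar

/-!
Every context-free language without the empty string has a grammar in Greibach normal form, all of
whose productions are `A → a B₁ ⋯ Bₖ`; a graph interpolation grammar simulates its leftmost
derivations.

*Normal form.* The left-corner transform works directly on an arbitrary grammar, with empty and
unit productions.  Its variables are `str β`, standing for what a suffix `β` of a right-hand side
derives, and `corner X Y`, standing for what a tree with root `X` derives to the right of a left
corner `Y`.  A nonempty string `a w` derived from `β` splits at the symbol `X` of `β` above `a`
(`Gen.exists_leftCorner`): `w` begins with an element of `corner X a` and continues with what the
rest of `β` derives.  This gives finitely many equations `sem A = ⋃ a · sem B₁ ⋯ sem Bₖ`, valid up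
to the empty string (`cons_mem_sem_iff`), and dropping variables that may be empty from the
right-hand sides leaves a system that reads exactly the nonempty strings (`run_prunedRules_iff`,
`exists_run_iff`).

*Graphs.* The addendum for `A → a B₁ ⋯ Bₖ` is a root labelled `A` whose only child is the lexeme
`a` and whose right siblings are labelled `B₁, …, Bₖ`; the target is the last of these nodes.  Then
every graph that occurs in a computation is a *comb*: a chain of siblings, each of which is terminal
or has a single lexeme below it.  A comb has exactly one frontier, read off from left to right
(`IsComb.isFrontier`, `IsComb.frontier_eq`).  The anchor of a move has no child, because the root of
the addendum already has one (`IsComb.anchor_pair_mem`), and the frontier constraint makes it the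
leftmost variable of the yield (`IsComb.mem_L_of_interpolation`); so a move replaces `u A γ` by
`u a B₁ ⋯ Bₖ γ`, as a leftmost derivation does, and every such replacement is a move
(`Represents.exists_of_step`, `Represents.exists_step`).
-/

/-! ### Runs of a one-stack system that consumes a symbol at each move -/

namespace Greibach

section Runs

variable {V α : Type*}

/-- `Run R γ w`: a pushdown system with rules `R` empties the stack `γ` while reading `w`.  The rule
`(A, a, Bs)` reads the symbol `a` and replaces the top `A` of the stack by `Bs`; it is the
production `A → a Bs` of a grammar in Greibach normal form. -/
inductive Run (R : Set (V × α × List V)) : List V → List α → Prop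
  | nil : Run R [] []
  | cons {A : V} {a : α} {Bs γ : List V} {w : List α} :
      (A, a, Bs) ∈ R → Run R (Bs ++ γ) w → Run R (A :: γ) (a :: w)

/-- The nonempty strings of the languages `sem A`. -/
def pos (sem : V → Language α) (A : V) : Language α :=
  {w | w ∈ sem A ∧ w ≠ []}

/-- `Prune sem Bs Cs`: the list `Cs` is obtained from `Bs` by dropping some entries whose language
contains the empty string. -/
inductive Prune (sem : V → Language α) : List V → List V → Prop
  | nil : Prune sem [] []
  | keep {Bs Cs : List V} (A : V) : Prune sem Bs Cs → Prune sem (A :: Bs) (A :: Cs)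
  | drop {Bs Cs : List V} {A : V} : [] ∈ sem A → Prune sem Bs Cs → Prune sem (A :: Bs) Cs

theorem Prune.length_le {sem : V → Language α} {Bs Cs : List V} (h : Prune sem Bs Cs) :
    Cs.length ≤ Bs.length := by
  induction h with
  | nil => simp
  | keep A _ ih => simpa using ih
  | drop _ _ ih => simp only [List.length_cons]; omega

theorem mem_prod_iff_exists_prune (sem : V → Language α) (Bs : List V) (w : List α) :
    w ∈ (Bs.map sem).prod ↔ ∃ Cs, Prune sem Bs Cs ∧ w ∈ (Cs.map (pos sem)).prod := by
  constructor
  · induction Bs generalizing w with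
    | nil => exact fun h => ⟨[], .nil, h⟩
    | cons A Bs ih =>
      intro h
      rw [List.map_cons, List.prod_cons, Language.mem_mul] at h
      obtain ⟨u, hu, v, hv, rfl⟩ := h
      obtain ⟨Cs, hC, hv⟩ := ih v hv
      by_cases h0 : u = []
      · subst h0
        exact ⟨Cs, .drop hu hC, by simpa using hv⟩
      · refine ⟨A :: Cs, .keep A hC, ?_⟩
        rw [List.map_cons, List.prod_cons, Language.mem_mul]
        exact ⟨u, ⟨hu, h0⟩, v, hv, rfl⟩
  · rintro ⟨Cs, hC, hw⟩
    induction hC generalizing w with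
    | nil => exact hw
    | keep A _ ih =>
      rw [List.map_cons, List.prod_cons, Language.mem_mul] at hw ⊢
      obtain ⟨u, hu, v, hv, rfl⟩ := hw
      exact ⟨u, hu.1, v, ih v hv, rfl⟩
    | drop h0 _ ih =>
      rw [List.map_cons, List.prod_cons, Language.mem_mul]
      exact ⟨[], h0, w, ih w hw, rfl⟩

/-- The rules obtained from `Base` by pruning right-hand sides. -/
def prunedRules (sem : V → Language α) (Base : V → α → List V → Prop) : Set (V × α × List V) :=
  {ρ | ∃ Bs, Base ρ.1 ρ.2.1 Bs ∧ Prune sem Bs ρ.2.2}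

/-- If the languages `sem A` satisfy, up to the empty string, the system of equations
`sem A = ⋃ a · sem Bs` over `Base A a Bs`, then the pruned system generates exactly their nonempty
strings. -/
theorem run_prunedRules_iff {sem : V → Language α} {Base : V → α → List V → Prop}
    (h : ∀ A a w, a :: w ∈ sem A ↔ ∃ Bs, Base A a Bs ∧ w ∈ (Bs.map sem).prod)
    (γ : List V) (w : List α) :
    Run (prunedRules sem Base) γ w ↔ w ∈ (γ.map (pos sem)).prod := by
  constructor
  · intro hr
    induction hr with
    | nil => exact Language.nil_mem_one
    | @cons A a Bs γ w hR _ ih =>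
      obtain ⟨Bs', hB, hP⟩ := hR
      rw [List.map_append, List.prod_append, Language.mem_mul] at ih
      obtain ⟨u, hu, v, hv, rfl⟩ := ih
      rw [List.map_cons, List.prod_cons, Language.mem_mul]
      refine ⟨a :: u, ⟨(h A a u).2 ⟨Bs', hB, ?_⟩, by simp⟩, v, hv, rfl⟩
      exact (mem_prod_iff_exists_prune sem Bs' u).2 ⟨Bs, hP, hu⟩
  · induction w generalizing γ with
    | nil =>
      cases γ with
      | nil => exact fun _ => .nil
      | cons A γ =>
        rw [List.map_cons, List.prod_cons, Language.mem_mul]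
        rintro ⟨u, hu, v, _, he⟩
        exact absurd (List.append_eq_nil_iff.1 he).1 hu.2
    | cons b w ih =>
      cases γ with
      | nil => intro hw; simp [Language.mem_one] at hw
      | cons A γ =>
        rw [List.map_cons, List.prod_cons, Language.mem_mul]
        rintro ⟨u, hu, v, hv, he⟩
        cases u with
        | nil => exact absurd rfl hu.2
        | cons a u =>
          obtain ⟨rfl, rfl⟩ := List.cons_eq_cons.1 he
          obtain ⟨Bs', hB, hu⟩ := (h A a u).1 hu.1
          obtain ⟨Bs, hP, hu⟩ := (mem_prod_iff_exists_prune sem Bs' u).1 hu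
          refine .cons ⟨Bs', hB, hP⟩ (ih _ ?_)
          rw [List.map_append, List.prod_append, Language.mem_mul]
          exact ⟨u, hu, v, hv, rfl⟩

end Runs

/-! ### Left corners of a context-free grammar -/

variable {α : Type*} (g : ContextFreeGrammar α)

/-- `Gen g β w`: the string `β` of symbols derives the terminal string `w`; a derivation presented
as a forest, one tree per symbol of `β`. -/
inductive Gen : List (Symbol α g.NT) → List α → Prop
  | nil : Gen [] []
  | terminal {β : List (Symbol α g.NT)} {w : List α} (a : α) :
      Gen β w → Gen (.terminal a :: β) (a :: w)
  | rule {r : ContextFreeRule α g.NT} {β : List (Symbol α g.NT)} {u v : List α} :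
      r ∈ g.rules → Gen r.output u → Gen β v → Gen (.nonterminal r.input :: β) (u ++ v)

variable {g}

theorem gen_append_iff {β γ : List (Symbol α g.NT)} {w : List α} :
    Gen g (β ++ γ) w ↔ ∃ u v, w = u ++ v ∧ Gen g β u ∧ Gen g γ v := by
  constructor
  · generalize hδ : β ++ γ = δ
    intro h
    induction h generalizing β with
    | nil =>
      obtain ⟨rfl, rfl⟩ := List.append_eq_nil_iff.1 hδ
      exact ⟨[], [], rfl, .nil, .nil⟩
    | @terminal δ w a hd ih =>
      cases β with
      | nil =>
        rw [List.nil_append] at hδ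
        subst hδ
        exact ⟨[], _, rfl, .nil, .terminal a hd⟩
      | cons X β =>
        obtain ⟨rfl, h⟩ := List.cons_eq_cons.1 hδ
        obtain ⟨u, v, rfl, hu, hv⟩ := ih h
        exact ⟨a :: u, v, rfl, .terminal a hu, hv⟩
    | @rule r δ u v hr ho hd _ ih =>
      cases β with
      | nil =>
        rw [List.nil_append] at hδ
        subst hδ
        exact ⟨[], _, rfl, .nil, .rule hr ho hd⟩
      | cons X β =>
        obtain ⟨rfl, h⟩ := List.cons_eq_cons.1 hδ
        obtain ⟨u', v', rfl, hu, hv⟩ := ih h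
        exact ⟨u ++ u', v', by simp, .rule hr ho hu, hv⟩
  · rintro ⟨u, v, rfl, hu, hv⟩
    induction hu with
    | nil => exact hv
    | terminal a _ ih => exact .terminal a ih
    | rule hr ho _ _ ih =>
      rw [List.append_assoc]
      exact .rule hr ho ih

theorem Gen.append {β γ : List (Symbol α g.NT)} {u v : List α} (hu : Gen g β u)
    (hv : Gen g γ v) : Gen g (β ++ γ) (u ++ v) :=
  gen_append_iff.2 ⟨u, v, rfl, hu, hv⟩

theorem gen_map_terminal (w : List α) : Gen g (w.map .terminal) w := by
  induction w with
  | nil => exact .nil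
  | cons a w ih => exact .terminal a ih

theorem Gen.derives {β : List (Symbol α g.NT)} {w : List α} (h : Gen g β w) :
    g.Derives β (w.map .terminal) := by
  induction h with
  | nil => exact Relation.ReflTransGen.refl
  | terminal a _ ih => exact ih.append_left [.terminal a]
  | @rule r β u v hr _ _ iho ih =>
    have h1 : g.Produces (.nonterminal r.input :: β) (r.output ++ β) := ⟨r, hr, .head β⟩
    rw [List.map_append]
    exact (h1.trans_derives (iho.append_right β)).trans (ih.append_left _)

theorem gen_of_derives {β : List (Symbol α g.NT)} {w : List α}
    (h : g.Derives β (w.map .terminal)) : Gen g β w := by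
  induction h using Relation.ReflTransGen.head_induction_on with
  | refl => exact gen_map_terminal w
  | head hp _ ih =>
    obtain ⟨r, hr, hw⟩ := hp
    obtain ⟨p, q, rfl, rfl⟩ := hw.exists_parts
    obtain ⟨u, z, rfl, hu, hz⟩ := gen_append_iff.1 ih
    obtain ⟨u, v, rfl, hu, hv⟩ := gen_append_iff.1 hu
    have := hu.append (Gen.rule hr hv hz)
    simpa using this

theorem mem_language_iff_gen (w : List α) :
    w ∈ g.language ↔ Gen g [.nonterminal g.initial] w :=
  ⟨gen_of_derives, Gen.derives⟩

variable (g)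

/-- `LeftCorner g X Y w`: some derivation tree with root `X` has `Y` on a path from the root all of
whose left side derives the empty string, and `w` is what the tree derives to the right of `Y`. -/
inductive LeftCorner (X : Symbol α g.NT) : Symbol α g.NT → List α → Prop
  | refl : LeftCorner X X []
  | step {r : ContextFreeRule α g.NT} {δ β : List (Symbol α g.NT)} {Y : Symbol α g.NT}
      {u v : List α} :
      r ∈ g.rules → r.output = δ ++ Y :: β → Gen g δ [] → Gen g β u →
      LeftCorner X (.nonterminal r.input) v → LeftCorner X Y (u ++ v)

variable {g}

theorem LeftCorner.snoc {r : ContextFreeRule α g.NT} {X Y : Symbol α g.NT} {u v : List α}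
    {δ β : List (Symbol α g.NT)} (hr : r ∈ g.rules) (ho : r.output = δ ++ X :: β)
    (hδ : Gen g δ []) (hβ : Gen g β v) (h : LeftCorner g X Y u) :
    LeftCorner g (.nonterminal r.input) Y (u ++ v) := by
  induction h with
  | refl =>
    have := LeftCorner.step hr ho hδ hβ (LeftCorner.refl (X := .nonterminal r.input))
    simpa using this
  | step hr' ho' hδ' hβ' _ ih =>
    rw [List.append_assoc]
    exact .step hr' ho' hδ' hβ' ih

theorem LeftCorner.gen {X Y : Symbol α g.NT} {u y : List α} (h : LeftCorner g X Y u)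
    (hY : Gen g [Y] y) : Gen g [X] (y ++ u) := by
  induction h generalizing y with
  | refl => simpa using hY
  | @step r δ β Y u v hr ho hδ hβ _ ih =>
    rw [← List.append_assoc]
    apply ih
    have h1 : Gen g r.output (y ++ u) := by
      rw [ho]
      exact hδ.append (hY.append hβ)
    simpa using Gen.rule hr h1 .nil

theorem LeftCorner.eq_or_mem_output {X Y : Symbol α g.NT} {u : List α}
    (h : LeftCorner g X Y u) : Y = X ∨ ∃ r ∈ g.rules, Y ∈ r.output := by
  cases h with
  | refl => exact .inl rfl
  | step hr ho _ _ _ => exact .inr ⟨_, hr, by simp [ho]⟩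

/-- The first symbol of a string derived from `β` is a left corner of a symbol of `β` preceded by
symbols deriving the empty string. -/
theorem Gen.exists_leftCorner {β : List (Symbol α g.NT)} {a : α} {w : List α}
    (h : Gen g β (a :: w)) :
    ∃ β₁ X β₂ u v, β = β₁ ++ X :: β₂ ∧ Gen g β₁ [] ∧ w = u ++ v ∧
      LeftCorner g X (.terminal a) u ∧ Gen g β₂ v := by
  generalize hx : a :: w = x at h
  induction h generalizing w with
  | nil => simp at hx
  | @terminal β x b hβ ih =>
    obtain ⟨rfl, rfl⟩ := List.cons_eq_cons.1 hx
    exact ⟨[], _, β, [], w, rfl, .nil, rfl, .refl, hβ⟩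
  | @rule r β u v hr ho hβ iho ih =>
    cases u with
    | nil =>
      obtain ⟨β₁, X, β₂, u, v, rfl, h1, rfl, h2, h3⟩ := ih hx
      exact ⟨_ :: β₁, X, β₂, u, v, rfl, Gen.rule hr ho h1, rfl, h2, h3⟩
    | cons b u =>
      obtain ⟨rfl, rfl⟩ := List.cons_eq_cons.1 hx
      obtain ⟨β₁, X, β₂, u, v', he, h1, rfl, h2, h3⟩ := iho rfl
      exact ⟨[], _, β, u ++ v', v, rfl, .nil, by simp, h2.snoc hr he h1 h3, hβ⟩

/-! ### The left-corner transform -/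

variable (g)

/-- The variables of the transformed grammar: `str β` generates what `β` derives, and `corner X Y`
generates what a tree with root `X` derives to the right of a left corner `Y`. -/
inductive Goal
  | str (β : List (Symbol α g.NT))
  | corner (X Y : Symbol α g.NT)

variable {g}

/-- The language that a goal stands for. -/
def Goal.sem : Goal g → Language α
  | .str β => {w | Gen g β w}
  | .corner X Y => {w | LeftCorner g X Y w}

variable (g)

/-- The productions `A → a Bs` of the left-corner transform, before the removal of empty
right-hand-side goals.  The condition on `a` in `str` keeps them finite in number for each goal. -/
inductive Base : Goal g → α → List (Goal g) → Prop
  | str {β₁ β₂ : List (Symbol α g.NT)} {X : Symbol α g.NT} {a : α} :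
      Gen g β₁ [] → (.terminal a = X ∨ ∃ r ∈ g.rules, .terminal a ∈ r.output) →
      Base (.str (β₁ ++ X :: β₂)) a [.corner X (.terminal a), .str β₂]
  | corner {r : ContextFreeRule α g.NT} {δ β : List (Symbol α g.NT)} {X Y : Symbol α g.NT}
      {a : α} {Bs : List (Goal g)} :
      r ∈ g.rules → r.output = δ ++ Y :: β → Gen g δ [] → Base (.str β) a Bs →
      Base (.corner X Y) a (Bs ++ [.corner X (.nonterminal r.input)])
  | skip {r : ContextFreeRule α g.NT} {δ β : List (Symbol α g.NT)} {X Y : Symbol α g.NT}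
      {a : α} {Bs : List (Goal g)} :
      r ∈ g.rules → r.output = δ ++ Y :: β → Gen g δ [] → Gen g β [] →
      Base (.corner X (.nonterminal r.input)) a Bs → Base (.corner X Y) a Bs

variable {g}

theorem Base.cons_mem_sem {A : Goal g} {a : α} {Bs : List (Goal g)} (h : Base g A a Bs)
    {w : List α} (hw : w ∈ (Bs.map Goal.sem).prod) : a :: w ∈ A.sem := by
  induction h generalizing w with
  | @str β₁ β₂ X a h1 _ =>
    simp only [List.map_cons, List.map_nil, List.prod_cons, List.prod_nil, mul_one,
      Language.mem_mul] at hw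
    obtain ⟨u, hu, v, hv, rfl⟩ := hw
    have h2 : Gen g [X] ([a] ++ u) := LeftCorner.gen hu (.terminal a .nil)
    exact h1.append (h2.append hv)
  | corner hr ho hδ _ ih =>
    rw [List.map_append, List.prod_append, Language.mem_mul] at hw
    obtain ⟨u, hu, v, hv, rfl⟩ := hw
    simp only [List.map_cons, List.map_nil, List.prod_cons, List.prod_nil, mul_one] at hv
    exact LeftCorner.step hr ho hδ (ih hu) hv
  | skip hr ho hδ hβ _ ih => exact LeftCorner.step hr ho hδ hβ (ih hw)

theorem exists_base_str {β : List (Symbol α g.NT)} {a : α} {w : List α}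
    (h : Gen g β (a :: w)) :
    ∃ Bs, Base g (.str β) a Bs ∧ w ∈ (Bs.map Goal.sem).prod := by
  obtain ⟨β₁, X, β₂, u, v, rfl, h1, rfl, h2, h3⟩ := h.exists_leftCorner
  refine ⟨_, .str h1 h2.eq_or_mem_output, ?_⟩
  simp only [List.map_cons, List.map_nil, List.prod_cons, List.prod_nil, mul_one,
    Language.mem_mul]
  exact ⟨u, h2, v, h3, rfl⟩

theorem exists_base_corner {X Y : Symbol α g.NT} {a : α} {w : List α}
    (h : LeftCorner g X Y (a :: w)) :
    ∃ Bs, Base g (.corner X Y) a Bs ∧ w ∈ (Bs.map Goal.sem).prod := by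
  generalize hx : a :: w = x at h
  induction h with
  | refl => simp at hx
  | @step r δ β Y u v hr ho hδ hβ hX ih =>
    cases u with
    | nil =>
      obtain ⟨Bs, hB, hw⟩ := ih hx
      exact ⟨Bs, .skip hr ho hδ hβ hB, hw⟩
    | cons b u =>
      obtain ⟨rfl, rfl⟩ := List.cons_eq_cons.1 hx
      obtain ⟨Bs, hB, hu⟩ := exists_base_str hβ
      refine ⟨_, .corner hr ho hδ hB, ?_⟩
      rw [List.map_append, List.prod_append, Language.mem_mul]
      exact ⟨u, hu, v, by rw [List.map_singleton, List.prod_singleton]; exact hX, rfl⟩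

theorem cons_mem_sem_iff (A : Goal g) (a : α) (w : List α) :
    a :: w ∈ A.sem ↔ ∃ Bs, Base g A a Bs ∧ w ∈ (Bs.map Goal.sem).prod := by
  refine ⟨fun h => ?_, fun ⟨Bs, hB, hw⟩ => hB.cons_mem_sem hw⟩
  cases A with
  | str β => exact exists_base_str h
  | corner X Y => exact exists_base_corner h

/-! ### Finiteness of the left-corner transform -/

variable (g)

/-- The symbols that occur in the grammar. -/
def symbols : Set (Symbol α g.NT) :=
  insert (.nonterminal g.initial)
    (⋃ r ∈ g.rules, {X | X ∈ Symbol.nonterminal r.input :: r.output})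

/-- The suffixes of the start string and of the right-hand sides. -/
def suffixes : Set (List (Symbol α g.NT)) :=
  {β | β <:+ [.nonterminal g.initial]} ∪ ⋃ r ∈ g.rules, {β | β <:+ r.output}

/-- A finite set of goals that is closed under the productions and contains the start goal. -/
def goals : Set (Goal g) :=
  Goal.str '' suffixes g ∪ Set.image2 Goal.corner (symbols g) (symbols g)

theorem finite_setOf_suffix {β : Type*} (l : List β) : {s | s <:+ l}.Finite :=
  l.tails.finite_toSet.subset fun _ hs => (List.mem_tails _ _).2 hs

theorem finite_symbols : (symbols g).Finite :=
  (g.rules.finite_toSet.biUnion fun _ _ => List.finite_toSet _).insert _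

theorem finite_goals : (goals g).Finite := by
  refine .union (.image _ (.union (finite_setOf_suffix _) ?_))
    ((finite_symbols g).image2 _ (finite_symbols g))
  exact g.rules.finite_toSet.biUnion fun _ _ => finite_setOf_suffix _

variable {g}

theorem str_mem_goals {β : List (Symbol α g.NT)} : .str β ∈ goals g ↔ β ∈ suffixes g := by
  simp [goals]

theorem corner_mem_goals {X Y : Symbol α g.NT} :
    .corner X Y ∈ goals g ↔ X ∈ symbols g ∧ Y ∈ symbols g := by
  simp [goals]

theorem mem_symbols_of_mem_output {r : ContextFreeRule α g.NT} (hr : r ∈ g.rules)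
    {X : Symbol α g.NT} (hX : X ∈ r.output) : X ∈ symbols g :=
  .inr (Set.mem_biUnion hr (by simp [hX]))

theorem input_mem_symbols {r : ContextFreeRule α g.NT} (hr : r ∈ g.rules) :
    .nonterminal r.input ∈ symbols g :=
  .inr (Set.mem_biUnion hr (by simp))

theorem mem_symbols_of_mem_suffixes {β : List (Symbol α g.NT)} (hβ : β ∈ suffixes g)
    {X : Symbol α g.NT} (hX : X ∈ β) : X ∈ symbols g := by
  rcases hβ with hβ | hβ
  · obtain rfl := List.mem_singleton.1 (List.IsSuffix.subset hβ hX)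
    exact .inl rfl
  · obtain ⟨r, hr, hβ⟩ := Set.mem_iUnion₂.1 hβ
    exact mem_symbols_of_mem_output hr (List.IsSuffix.subset hβ hX)

theorem suffixes_of_isSuffix {β γ : List (Symbol α g.NT)} (hβ : β ∈ suffixes g)
    (h : γ <:+ β) : γ ∈ suffixes g := by
  rcases hβ with hβ | hβ
  · exact .inl (h.trans hβ)
  · obtain ⟨r, hr, hβ⟩ := Set.mem_iUnion₂.1 hβ
    exact .inr (Set.mem_biUnion hr (h.trans hβ))

theorem mem_suffixes_of_output_eq {r : ContextFreeRule α g.NT} (hr : r ∈ g.rules)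
    {δ β : List (Symbol α g.NT)} {Y : Symbol α g.NT} (ho : r.output = δ ++ Y :: β) :
    β ∈ suffixes g :=
  .inr (Set.mem_biUnion hr ⟨δ ++ [Y], by simp [ho]⟩)

theorem Base.closed {A : Goal g} {a : α} {Bs : List (Goal g)} (h : Base g A a Bs)
    (hA : A ∈ goals g) : .terminal a ∈ symbols g ∧ ∀ B ∈ Bs, B ∈ goals g := by
  induction h with
  | @str β₁ β₂ X a _ ha =>
    rw [str_mem_goals] at hA
    have hX := mem_symbols_of_mem_suffixes hA (X := X) (by simp)
    have h2 : β₂ ∈ suffixes g := suffixes_of_isSuffix hA ⟨β₁ ++ [X], by simp⟩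
    have h1 : .terminal a ∈ symbols g := by
      rcases ha with rfl | ⟨r, hr, ha⟩
      · exact hX
      · exact mem_symbols_of_mem_output hr ha
    refine ⟨h1, ?_⟩
    simp only [List.mem_cons, List.not_mem_nil, or_false, forall_eq_or_imp, forall_eq]
    exact ⟨corner_mem_goals.2 ⟨hX, h1⟩, str_mem_goals.2 h2⟩
  | corner hr ho _ _ ih =>
    rw [corner_mem_goals] at hA
    obtain ⟨h1, h2⟩ := ih (str_mem_goals.2 (mem_suffixes_of_output_eq hr ho))
    refine ⟨h1, fun B hB => ?_⟩
    rcases List.mem_append.1 hB with hB | hB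
    · exact h2 B hB
    · obtain rfl := List.mem_singleton.1 hB
      exact corner_mem_goals.2 ⟨hA.1, input_mem_symbols hr⟩
  | skip hr _ _ _ _ ih =>
    exact ih (corner_mem_goals.2 ⟨(corner_mem_goals.1 hA).1, input_mem_symbols hr⟩)

theorem Base.length_le {A : Goal g} {a : α} {Bs : List (Goal g)} (h : Base g A a Bs) :
    Bs.length ≤ 3 := by
  induction h with
  | str _ _ => simp
  | corner _ _ _ h _ => cases h; simp
  | skip _ _ _ _ _ ih => exact ih

/-- **Greibach normal form**: the nonempty strings of a context-free language are read by a finite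
pushdown system each of whose moves consumes one symbol. -/
theorem exists_run_iff (g : ContextFreeGrammar α) :
    ∃ (n : ℕ) (S : Fin n) (R : Set (Fin n × α × List (Fin n))), R.Finite ∧
      ∀ w, Run R [S] w ↔ w ∈ g.language ∧ w ≠ [] := by
  have : Finite (goals g) := finite_goals g
  obtain ⟨n, ⟨e⟩⟩ := Finite.exists_equiv_fin (goals g)
  obtain ⟨dec, hmem, hdec⟩ : ∃ dec : Fin n → Goal g,
      (∀ i, dec i ∈ goals g) ∧ ∀ A ∈ goals g, ∃ i, dec i = A :=
    ⟨fun i => (e.symm i).1, fun i => (e.symm i).2,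
      fun A hA => ⟨e ⟨A, hA⟩, congrArg Subtype.val (e.symm_apply_apply ⟨A, hA⟩)⟩⟩
  obtain ⟨S, hS⟩ := hdec (.str [.nonterminal g.initial])
    (str_mem_goals.2 (.inl List.suffix_rfl))
  have hmap : ∀ Bs : List (Fin n),
      (Bs.map fun i => (dec i).sem) = (Bs.map dec).map Goal.sem := fun Bs =>
    (List.map_map (f := dec) (g := Goal.sem) (l := Bs)).symm
  have hB : ∀ i a w, a :: w ∈ (dec i).sem ↔
      ∃ Bs : List (Fin n), Base g (dec i) a (Bs.map dec) ∧
        w ∈ (Bs.map fun i => (dec i).sem).prod := by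
    intro i a w
    simp only [hmap]
    refine (cons_mem_sem_iff (dec i) a w).trans ⟨?_, fun ⟨Bs, h⟩ => ⟨_, h⟩⟩
    rintro ⟨Bs, hBs, hw⟩
    have hr : Bs ∈ Set.range (List.map dec) := by
      rw [Set.range_list_map]
      exact fun A hA => hdec A ((hBs.closed (hmem i)).2 A hA)
    obtain ⟨Cs, rfl⟩ := hr
    exact ⟨Cs, hBs, hw⟩
  refine ⟨n, S, prunedRules (fun i => (dec i).sem) fun i a Bs => Base g (dec i) a (Bs.map dec),
    ?_, fun w => ?_⟩
  · have hT : {a : α | Symbol.terminal a ∈ symbols g}.Finite :=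
      (finite_symbols g).preimage fun a _ b _ h => by simpa using h
    refine (Set.finite_univ.prod (hT.prod (List.finite_length_le _ 3))).subset ?_
    rintro ⟨i, a, Cs⟩ ⟨Bs, hBs, hP⟩
    refine ⟨Set.mem_univ _, (hBs.closed (hmem i)).1, hP.length_le.trans ?_⟩
    rw [← List.length_map dec]
    exact hBs.length_le
  · rw [run_prunedRules_iff hB, mem_language_iff_gen, List.map_singleton, List.prod_singleton]
    change w ∈ (dec S).sem ∧ w ≠ [] ↔ _
    rw [hS]
    rfl

end Greibach

/-! ### Consecutive entries of a list -/

namespace List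

variable {β γ : Type*}

/-- `Adj l m n`: somewhere in `l` the entry `m` is immediately followed by `n`. -/
def Adj : List β → β → β → Prop
  | [], _, _ => False
  | a :: l, m, n => (a = m ∧ l.head? = some n) ∨ Adj l m n

theorem adj_append {l₁ l₂ : List β} {m n : β} :
    Adj (l₁ ++ l₂) m n ↔
      Adj l₁ m n ∨ (l₁.getLast? = some m ∧ l₂.head? = some n) ∨ Adj l₂ m n := by
  induction l₁ with
  | nil => simp [Adj]
  | cons a l ih =>
    rw [cons_append, Adj, Adj, ih]
    cases l with
    | nil => simp [Adj]
    | cons b l => simp [or_assoc]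

theorem Adj.mem_left {l : List β} {m n : β} (h : Adj l m n) : m ∈ l := by
  induction l with
  | nil => exact h.elim
  | cons a l ih =>
    rcases h with h | h
    · simp [h.1]
    · exact mem_cons_of_mem _ (ih h)

theorem Adj.mem_right {l : List β} {m n : β} (h : Adj l m n) : n ∈ l := by
  induction l with
  | nil => exact h.elim
  | cons a l ih =>
    rcases h with h | h
    · exact mem_cons_of_mem _ (mem_of_mem_head? h.2)
    · exact mem_cons_of_mem _ (ih h)

theorem adj_map {f : β → γ} {l : List β} {x y : γ} :
    Adj (l.map f) x y ↔ ∃ m n, Adj l m n ∧ f m = x ∧ f n = y := by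
  induction l with
  | nil => simp [Adj]
  | cons a l ih =>
    rw [map_cons, Adj, ih]
    constructor
    · rintro (⟨rfl, h⟩ | ⟨m, n, h, rfl, rfl⟩)
      · rw [head?_map, Option.map_eq_some_iff] at h
        obtain ⟨n, hn, rfl⟩ := h
        exact ⟨a, n, .inl ⟨rfl, hn⟩, rfl, rfl⟩
      · exact ⟨m, n, .inr h, rfl, rfl⟩
    · rintro ⟨m, n, ⟨rfl, h⟩ | h, rfl, rfl⟩
      · exact .inl ⟨rfl, by simp [h]⟩
      · exact .inr ⟨m, n, h, rfl, rfl⟩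

theorem Adj.idxOf_eq [DecidableEq β] {l : List β} (hl : l.Nodup) {m n : β} (h : Adj l m n) :
    l.idxOf n = l.idxOf m + 1 := by
  induction l with
  | nil => exact h.elim
  | cons a l ih =>
    obtain ⟨ha, hl⟩ := nodup_cons.1 hl
    rcases h with ⟨rfl, h⟩ | h
    · have hn : a ≠ n := fun e => ha (e ▸ mem_of_mem_head? h)
      cases l with
      | nil => simp at h
      | cons b l =>
        obtain rfl : b = n := by simpa using h
        rw [idxOf_cons_ne _ hn, idxOf_cons_self, idxOf_cons_self]
    · have hm : a ≠ m := fun e => ha (e ▸ h.mem_left)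
      have hn : a ≠ n := fun e => ha (e ▸ h.mem_right)
      rw [idxOf_cons_ne _ hm, idxOf_cons_ne _ hn, ih hl h]

theorem Adj.right_unique {l : List β} (hl : l.Nodup) {m n n' : β} (h : Adj l m n)
    (h' : Adj l m n') : n = n' := by
  classical
  exact (idxOf_inj h.mem_right).1 (by rw [h.idxOf_eq hl, h'.idxOf_eq hl])

theorem Adj.left_unique {l : List β} (hl : l.Nodup) {m m' n : β} (h : Adj l m n)
    (h' : Adj l m' n) : m = m' := by
  classical
  have h1 := h.idxOf_eq hl
  have h2 := h'.idxOf_eq hl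
  exact (idxOf_inj h.mem_left).1 (by omega)

theorem Adj.ne {l : List β} (hl : l.Nodup) {m n : β} (h : Adj l m n) : m ≠ n := by
  classical
  rintro rfl
  have := h.idxOf_eq hl
  omega

theorem Adj.head?_ne {l : List β} (hl : l.Nodup) {m n : β} (h : Adj l m n) :
    l.head? ≠ some n := by
  classical
  intro hn
  cases l with
  | nil => exact h
  | cons a l =>
    obtain rfl : a = n := by simpa using hn
    have := h.idxOf_eq hl
    rw [idxOf_cons_self] at this
    omega

theorem exists_adj_of_mem {l : List β} {n : β} (hn : n ∈ l) (h : l.head? ≠ some n) :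
    ∃ m, Adj l m n := by
  induction l with
  | nil => simp at hn
  | cons a l ih =>
    have hn : n ∈ l := by
      rcases mem_cons.1 hn with rfl | hn
      · simp at h
      · exact hn
    by_cases h' : l.head? = some n
    · exact ⟨a, .inl ⟨rfl, h'⟩⟩
    · obtain ⟨m, hm⟩ := ih hn h'
      exact ⟨m, .inr hm⟩

theorem reflTransGen_adj_of_mem {a n : β} {l : List β} (hn : n ∈ a :: l) :
    Relation.ReflTransGen (Adj (a :: l)) a n := by
  induction l generalizing a with
  | nil => rw [mem_singleton.1 hn]
  | cons b l ih =>
    rcases mem_cons.1 hn with rfl | hn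
    · exact .refl
    · exact .head (.inl ⟨rfl, rfl⟩) (Relation.ReflTransGen.mono (fun _ _ => Or.inr) _ _ (ih hn))

theorem isChain_adj (l : List β) : l.IsChain (Adj l) := by
  induction l with
  | nil => exact .nil
  | cons a l ih =>
    cases l with
    | nil => exact .singleton a
    | cons b l => exact .cons_cons (.inl ⟨rfl, rfl⟩) (ih.imp fun _ _ h => .inr h)

/-- A rearrangement of a list without repetitions whose consecutive entries are consecutive in the
original list is that list. -/
theorem Perm.eq_of_isChain_adj {c w : List β} (hc : c.Nodup) (hp : w.Perm c)
    (hw : w.IsChain (Adj c)) : w = c := by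
  classical
  have key : ∀ l : List β, l.IsChain (Adj c) →
      l.Pairwise fun m n => c.idxOf m < c.idxOf n := by
    intro l hl
    have : IsTrans β fun m n => c.idxOf m < c.idxOf n := ⟨fun _ _ _ => lt_trans⟩
    refine isChain_iff_pairwise.1 (hl.imp fun m n h => ?_)
    have := h.idxOf_eq hc
    omega
  refine hp.eq_of_pairwise (fun m n _ _ h h' => absurd h h'.not_gt) (key w hw)
    (key c (isChain_adj c))

/-- Adjacency after the entry `q` of a list is replaced by a list with first entry `s` and last
entry `t`. -/
theorem adj_replace_iff {x y z : List β} {q s t : β} (hl : (x ++ q :: y).Nodup)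
    (hs : z.head? = some s) (ht : z.getLast? = some t) (m n : β) :
    Adj (x ++ z ++ y) m n ↔
      (Adj (x ++ q :: y) m n ∧ m ≠ q ∧ n ≠ q) ∨ Adj z m n ∨
      (Adj (x ++ q :: y) m q ∧ n = s) ∨ (Adj (x ++ q :: y) q n ∧ m = t) := by
  have hz : z ≠ [] := by rintro rfl; simp at hs
  have hqx : q ∉ x := fun h => (nodup_append.1 hl).2.2 q h q (by simp) rfl
  have hqy : q ∉ y := (nodup_cons.1 (nodup_append.1 hl).2.1).1
  have hx1 : ∀ m, ¬ Adj x q m := fun m h => hqx h.mem_left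
  have hx2 : ∀ m, ¬ Adj x m q := fun m h => hqx h.mem_right
  have hy1 : ∀ m, ¬ Adj y q m := fun m h => hqy h.mem_left
  have hy2 : ∀ m, ¬ Adj y m q := fun m h => hqy h.mem_right
  have hx3 : x.getLast? ≠ some q := fun h => hqx (mem_of_mem_getLast? h)
  have hy3 : y.head? ≠ some q := fun h => hqy (mem_of_mem_head? h)
  have e1 : ∀ m n, Adj (x ++ q :: y) m n ↔ Adj x m n ∨ (x.getLast? = some m ∧ q = n) ∨
      (q = m ∧ y.head? = some n) ∨ Adj y m n := by
    intro m n
    rw [adj_append, Adj, head?_cons, Option.some_inj]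
  have e2 : Adj (x ++ z ++ y) m n ↔ Adj x m n ∨ (x.getLast? = some m ∧ s = n) ∨ Adj z m n ∨
      (t = m ∧ y.head? = some n) ∨ Adj y m n := by
    rw [append_assoc, adj_append, adj_append, head?_append_of_ne_nil _ hz, hs, ht,
      Option.some_inj, Option.some_inj]
  have e3 : Adj (x ++ q :: y) m q ↔ x.getLast? = some m := by
    rw [e1]
    exact ⟨fun h => h.elim (fun h => absurd h (hx2 m)) fun h => h.elim (·.1) fun h =>
      h.elim (fun h => absurd h.2 hy3) fun h => absurd h (hy2 m), fun h => .inr (.inl ⟨h, rfl⟩)⟩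
  have e4 : Adj (x ++ q :: y) q n ↔ y.head? = some n := by
    rw [e1]
    exact ⟨fun h => h.elim (fun h => absurd h (hx1 n)) fun h =>
      h.elim (fun h => absurd h.1 hx3) fun h => h.elim (·.2) fun h => absurd h (hy1 n),
      fun h => .inr (.inr (.inl ⟨rfl, h⟩))⟩
  rw [e2, e1, e3, e4]
  constructor
  · rintro (h | ⟨h, rfl⟩ | h | ⟨rfl, h⟩ | h)
    · exact .inl ⟨.inl h, by rintro rfl; exact hx1 _ h, by rintro rfl; exact hx2 _ h⟩
    · exact .inr (.inr (.inl ⟨h, rfl⟩))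
    · exact .inr (.inl h)
    · exact .inr (.inr (.inr ⟨h, rfl⟩))
    · exact .inl ⟨.inr (.inr (.inr h)), by rintro rfl; exact hy1 _ h, by rintro rfl; exact hy2 _ h⟩
  · rintro (⟨h | ⟨_, h⟩ | ⟨h, _⟩ | h, hm, hn⟩ | h | ⟨h, rfl⟩ | ⟨h, rfl⟩)
    · exact .inl h
    · exact absurd h.symm hn
    · exact absurd h.symm hm
    · exact .inr (.inr (.inr (.inr h)))
    · exact .inr (.inr (.inl h))
    · exact .inr (.inl ⟨h, rfl⟩)
    · exact .inr (.inr (.inr (.inl ⟨rfl, h⟩)))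

/-- In a list of symbols followed by variables, everything before a variable that has only symbols
on its left is the block of symbols. -/
theorem eq_map_of_append_inl_cons {V α : Type*} {l l' : List (V ⊕ α)} {A : V} {u : List α}
    {γ : List V} (hl : ∀ x ∈ l, ∃ a, x = Sum.inr a)
    (h : l ++ Sum.inl A :: l' = u.map Sum.inr ++ γ.map Sum.inl) :
    l = u.map Sum.inr ∧ Sum.inl A :: l' = γ.map Sum.inl := by
  induction l generalizing u with
  | nil =>
    cases u with
    | nil => exact ⟨rfl, h⟩
    | cons a u => simp at h
  | cons x l ih =>
    obtain ⟨b, rfl⟩ := hl x (by simp)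
    cases u with
    | nil => cases γ <;> simp at h
    | cons a u =>
      rw [cons_append, map_cons, cons_append, cons_eq_cons] at h
      obtain ⟨h1, h2⟩ := ih (fun x hx => hl x (mem_cons_of_mem _ hx)) h.2
      exact ⟨by rw [h.1, h1, map_cons], h2⟩

end List

/-! ### Comb-shaped parse graphs -/

namespace ParseGraph

variable {V α : Type*}

/-- `Γ` is a comb: its nonlexical nodes are the first components of `P`, linked from left to right
by sibling edges, and each of them is either terminal, recorded as a pair `(n, n)` of `P`, or has a
lexeme `a` as its only child, recorded as `(n, a)`. -/
structure IsComb (Γ : ParseGraph V α) (P : List (ℕ × ℕ)) : Prop where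
  nodup_fst : (P.map Prod.fst).Nodup
  nodup_snd : (P.map Prod.snd).Nodup
  mem_N : ∀ n, n ∈ Γ.N ↔ n ∈ P.map Prod.fst
  mem_L : ∀ n, n ∈ Γ.L ↔ ∃ m, (m, n) ∈ P ∧ m ≠ n
  root : (P.map Prod.fst).head? = some Γ.root
  E_iff : ∀ m n, Γ.E m n ↔ (m, n) ∈ P ∧ m ≠ n
  F_iff : ∀ m n, Γ.F m n ↔ (P.map Prod.fst).Adj m n

/-- The list `P` and the labelling `lab` describe a comb. -/
structure IsCombData (lab : ℕ → V ⊕ α) (P : List (ℕ × ℕ)) : Prop where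
  ne_nil : P ≠ []
  nodup_fst : (P.map Prod.fst).Nodup
  nodup_snd : (P.map Prod.snd).Nodup
  not_mem : ∀ p ∈ P, p.1 ≠ p.2 → p.2 ∉ P.map Prod.fst
  lab_fst : ∀ p ∈ P, ∃ A, lab p.1 = Sum.inl A
  lab_snd : ∀ p ∈ P, p.1 ≠ p.2 → ∃ a, lab p.2 = Sum.inr a

theorem pair_eq_of_fst {P : List (ℕ × ℕ)} (h : (P.map Prod.fst).Nodup) {m x y : ℕ}
    (hx : (m, x) ∈ P) (hy : (m, y) ∈ P) : x = y :=
  congrArg Prod.snd (List.inj_on_of_nodup_map h hx hy rfl)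

theorem pair_eq_of_snd {P : List (ℕ × ℕ)} (h : (P.map Prod.snd).Nodup) {x y n : ℕ}
    (hx : (x, n) ∈ P) (hy : (y, n) ∈ P) : x = y :=
  congrArg Prod.fst (List.inj_on_of_nodup_map h hx hy rfl)

/-- The comb described by `P` and `lab`. -/
def ofComb (lab : ℕ → V ⊕ α) (P : List (ℕ × ℕ)) (h : IsCombData lab P) : ParseGraph V α where
  N := (P.map Prod.fst).toFinset
  L := ((P.filter fun p => p.1 ≠ p.2).map Prod.snd).toFinset
  root := (P.head h.ne_nil).1
  label := lab
  E m n := (m, n) ∈ P ∧ m ≠ n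
  F m n := (P.map Prod.fst).Adj m n
  disjoint := by
    rw [Finset.disjoint_right]
    intro n hn
    obtain ⟨⟨m, n⟩, hp, rfl⟩ := List.mem_map.1 (List.mem_toFinset.1 hn)
    obtain ⟨hp, hne⟩ := List.mem_filter.1 hp
    rw [List.mem_toFinset]
    exact h.not_mem _ hp (by simpa using hne)
  root_mem := List.mem_toFinset.2 (List.mem_map_of_mem (List.head_mem _))
  label_N n hn := by
    obtain ⟨p, hp, rfl⟩ := List.mem_map.1 (List.mem_toFinset.1 hn)
    exact h.lab_fst p hp
  label_L n hn := by
    obtain ⟨p, hp, rfl⟩ := List.mem_map.1 (List.mem_toFinset.1 hn)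
    obtain ⟨hp, hne⟩ := List.mem_filter.1 hp
    exact h.lab_snd p hp (by simpa using hne)
  E_mem m n hE := by
    refine ⟨List.mem_toFinset.2 (List.mem_map.2 ⟨_, hE.1, rfl⟩), Finset.mem_union_right _ ?_⟩
    exact List.mem_toFinset.2
      (List.mem_map.2 ⟨_, List.mem_filter.2 ⟨hE.1, by simpa using hE.2⟩, rfl⟩)
  F_mem m n hF := ⟨List.mem_toFinset.2 hF.mem_left, List.mem_toFinset.2 hF.mem_right⟩
  E_fun m n n' hE hE' := pair_eq_of_fst h.nodup_fst hE.1 hE'.1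
  F_fun m n n' hF hF' := hF.right_unique h.nodup_fst hF'
  dominator n hn hr := by
    rcases Finset.mem_union.1 hn with hn | hn
    · rw [List.mem_toFinset] at hn
      have hh : (P.map Prod.fst).head? ≠ some n := by
        rw [List.head?_map, List.head?_eq_some_head h.ne_nil]
        simpa using fun e => hr e.symm
      obtain ⟨m, hm⟩ := List.exists_adj_of_mem hn hh
      refine ⟨m, .inr hm, ?_⟩
      rintro m' (hm' | hm')
      · exact absurd hn (h.not_mem _ hm'.1 hm'.2)
      · exact hm'.left_unique h.nodup_fst hm
    · obtain ⟨⟨m, n⟩, hp, rfl⟩ := List.mem_map.1 (List.mem_toFinset.1 hn)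
      obtain ⟨hp, hne⟩ := List.mem_filter.1 hp
      have hne : m ≠ n := by simpa using hne
      refine ⟨m, .inl ⟨hp, hne⟩, ?_⟩
      rintro m' (hm' | hm')
      · exact pair_eq_of_snd h.nodup_snd hm'.1 hp
      · exact absurd hm'.mem_right (h.not_mem _ hp hne)
  not_E_F m n hE hF := h.not_mem _ hE.1 hE.2 hF.mem_right
  root_top m := by
    have hr : (P.map Prod.fst).head? = some (P.head h.ne_nil).1 := by
      rw [List.head?_map, List.head?_eq_some_head h.ne_nil, Option.map_some]
    exact ⟨fun hE => h.not_mem _ hE.1 hE.2 (List.mem_of_mem_head? hr),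
      fun hF => hF.head?_ne h.nodup_fst hr⟩
  reachable n hn := by
    have key : ∀ n ∈ P.map Prod.fst, Relation.ReflTransGen
        (fun x y => ((x, y) ∈ P ∧ x ≠ y) ∨ (P.map Prod.fst).Adj x y) (P.head h.ne_nil).1 n := by
      obtain ⟨p, P, rfl⟩ := List.exists_cons_of_ne_nil h.ne_nil
      exact fun n hn => Relation.ReflTransGen.mono (fun _ _ => Or.inr) _ _
        (List.reflTransGen_adj_of_mem hn)
    rcases Finset.mem_union.1 hn with hn | hn
    · exact key n (List.mem_toFinset.1 hn)
    · obtain ⟨⟨m, n⟩, hp, rfl⟩ := List.mem_map.1 (List.mem_toFinset.1 hn)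
      obtain ⟨hp, hne⟩ := List.mem_filter.1 hp
      exact .tail (key m (List.mem_map.2 ⟨_, hp, rfl⟩)) (.inl ⟨hp, by simpa using hne⟩)

theorem isComb_ofComb {lab : ℕ → V ⊕ α} {P : List (ℕ × ℕ)} (h : IsCombData lab P) :
    (ofComb lab P h).IsComb P where
  nodup_fst := h.nodup_fst
  nodup_snd := h.nodup_snd
  mem_N n := List.mem_toFinset
  mem_L n := by simp [ofComb]
  root := by
    rw [List.head?_map, List.head?_eq_some_head h.ne_nil]
    rfl
  E_iff _ _ := Iff.rfl
  F_iff _ _ := Iff.rfl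

namespace IsComb

variable {Γ : ParseGraph V α} {P : List (ℕ × ℕ)}

theorem not_mem_N_of_ne (h : Γ.IsComb P) {m n : ℕ} (hp : (m, n) ∈ P) (hne : m ≠ n) : n ∉ Γ.N :=
  fun hn => Finset.disjoint_left.1 Γ.disjoint hn ((h.mem_L n).2 ⟨m, hp, hne⟩)

theorem eq_of_mem_N (h : Γ.IsComb P) {m n : ℕ} (hp : (m, n) ∈ P) (hn : n ∈ Γ.N) : m = n :=
  by_contra fun hne => h.not_mem_N_of_ne hp hne hn

theorem not_E_of_mem_N (h : Γ.IsComb P) {m n : ℕ} (hn : n ∈ Γ.N) : ¬ Γ.E m n := fun hE =>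
  h.not_mem_N_of_ne ((h.E_iff m n).1 hE).1 ((h.E_iff m n).1 hE).2 hn

theorem fst_mem_N (h : Γ.IsComb P) {p : ℕ × ℕ} (hp : p ∈ P) : p.1 ∈ Γ.N :=
  (h.mem_N _).2 (List.mem_map_of_mem hp)

theorem snd_mem (h : Γ.IsComb P) {p : ℕ × ℕ} (hp : p ∈ P) : p.2 ∈ Γ.N ∪ Γ.L := by
  rw [Finset.mem_union]
  by_cases hne : p.1 = p.2
  · exact .inl (hne ▸ h.fst_mem_N hp)
  · exact .inr ((h.mem_L _).2 ⟨p.1, hp, hne⟩)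

theorem isTerminal_iff (h : Γ.IsComb P) (n : ℕ) : Γ.IsTerminal n ↔ n ∈ P.map Prod.snd := by
  constructor
  · rintro ⟨hn, hE⟩
    rcases Finset.mem_union.1 hn with hn | hn
    · obtain ⟨⟨m, x⟩, hp, rfl⟩ := List.mem_map.1 ((h.mem_N n).1 hn)
      by_cases hne : m = x
      · exact List.mem_map.2 ⟨_, hp, hne.symm⟩
      · exact absurd ((h.E_iff m x).2 ⟨hp, hne⟩) (hE x)
    · obtain ⟨m, hp, _⟩ := (h.mem_L n).1 hn
      exact List.mem_map.2 ⟨_, hp, rfl⟩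
  · intro hn
    obtain ⟨⟨m, n⟩, hp, rfl⟩ := List.mem_map.1 hn
    refine ⟨h.snd_mem hp, fun k hE => ?_⟩
    have hN := (Γ.E_mem n k hE).1
    obtain rfl := h.eq_of_mem_N hp hN
    have hk := (h.E_iff m k).1 hE
    exact hk.2 (pair_eq_of_fst h.nodup_fst hp hk.1)

/-- Only lexemes have a parent in a comb, since the spine consists of the root and its right
siblings. -/
theorem eq_of_up (h : Γ.IsComb P) {m p : ℕ} (hu : Γ.Up m p) : Γ.E p m := by
  obtain ⟨c, hc, hE⟩ := hu
  cases hc with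
  | refl => exact hE
  | tail _ hF => exact absurd hE (h.not_E_of_mem_N (Γ.F_mem _ _ hF).1)

/-- In a comb, a node is succeeded by the right sibling of the spine node above it (or of itself)
and by the child of that sibling. -/
theorem succ_iff (h : Γ.IsComb P) (m n : ℕ) :
    Γ.Succ m n ↔ ∃ x y, (x = m ∨ Γ.E x m) ∧ Γ.F x y ∧ (n = y ∨ Γ.E y n) := by
  constructor
  · rintro ⟨x, y, hu, hF, hd⟩
    refine ⟨x, y, ?_, hF, ?_⟩
    · cases hu with
      | refl => exact .inl rfl
      | tail hu hx =>
        have hx := h.eq_of_up hx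
        cases hu with
        | refl => exact .inr hx
        | tail _ hy => exact absurd (h.eq_of_up hy) (fun hy =>
            h.not_E_of_mem_N (Γ.E_mem _ _ hy).1 hx)
    · cases hd with
      | refl => exact .inl rfl
      | tail hd hn =>
        cases hd with
        | refl => exact .inr hn
        | tail _ hy => exact absurd hy (h.not_E_of_mem_N (Γ.E_mem _ _ hn).1)
  · rintro ⟨x, y, hx, hF, hy⟩
    refine ⟨x, y, ?_, hF, ?_⟩
    · rcases hx with rfl | hx
      · exact .refl
      · exact .single ⟨m, .refl, hx⟩
    · rcases hy with rfl | hy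
      · exact .refl
      · exact .single hy

theorem owner_eq (h : Γ.IsComb P) {x m m' : ℕ} (hx : x ∈ Γ.N) (hp : (m', m) ∈ P)
    (hm : x = m ∨ Γ.E x m) : x = m' := by
  rcases hm with rfl | hm
  · exact (h.eq_of_mem_N hp hx).symm
  · exact pair_eq_of_snd h.nodup_snd ((h.E_iff x m).1 hm).1 hp

theorem owner_or (h : Γ.IsComb P) {m m' : ℕ} (hp : (m', m) ∈ P) : m' = m ∨ Γ.E m' m := by
  by_cases hne : m' = m
  · exact .inl hne
  · exact .inr ((h.E_iff _ _).2 ⟨hp, hne⟩)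

theorem adj_of_succ (h : Γ.IsComb P) {m n : ℕ} (hm : m ∈ P.map Prod.snd)
    (hn : n ∈ P.map Prod.snd) (hs : Γ.Succ m n) : (P.map Prod.snd).Adj m n := by
  obtain ⟨⟨m', m⟩, hmP, rfl⟩ := List.mem_map.1 hm
  obtain ⟨⟨n', n⟩, hnP, rfl⟩ := List.mem_map.1 hn
  obtain ⟨x, y, hx, hF, hy⟩ := (h.succ_iff m n).1 hs
  obtain rfl := h.owner_eq (Γ.F_mem _ _ hF).1 hmP hx
  obtain rfl := h.owner_eq (Γ.F_mem _ _ hF).2 hnP (hy.imp_left Eq.symm)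
  obtain ⟨⟨x', m₀⟩, ⟨y', n₀⟩, hA, rfl, rfl⟩ := List.adj_map.1 ((h.F_iff _ _).1 hF)
  obtain rfl := pair_eq_of_fst h.nodup_fst hA.mem_left hmP
  obtain rfl := pair_eq_of_fst h.nodup_fst hA.mem_right hnP
  exact List.adj_map.2 ⟨_, _, hA, rfl, rfl⟩

theorem immSucc_of_adj (h : Γ.IsComb P) {m n : ℕ} (hA : (P.map Prod.snd).Adj m n) :
    Γ.ImmSucc m n := by
  obtain ⟨⟨m', m⟩, ⟨n', n⟩, hP, rfl, rfl⟩ := List.adj_map.1 hA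
  have hF : Γ.F m' n' := (h.F_iff _ _).2 (List.adj_map.2 ⟨_, _, hP, rfl, rfl⟩)
  have hm := hP.mem_left
  have hn := hP.mem_right
  refine ⟨(h.succ_iff m n).2
    ⟨m', n', h.owner_or hm, hF, (h.owner_or hn).imp_left Eq.symm⟩, fun p hmp hpn => ?_⟩
  -- An intermediate node would belong to the tooth of `n'`, which would be its own sibling.
  exfalso
  obtain ⟨x, y, hx, hxy, hy⟩ := (h.succ_iff m p).1 hmp
  obtain ⟨x', y', hx', hxy', hy'⟩ := (h.succ_iff p n).1 hpn
  obtain rfl := h.owner_eq (Γ.F_mem _ _ hxy).1 hm hx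
  obtain rfl := h.owner_eq (Γ.F_mem _ _ hxy').2 hn (hy'.imp_left Eq.symm)
  obtain rfl := Γ.F_fun _ _ _ hF hxy
  have hx'N := (Γ.F_mem _ _ hxy').1
  have hyN := (Γ.F_mem _ _ hxy).2
  have he : x' = y' := by
    rcases hy with rfl | hy
    · rcases hx' with rfl | hx'
      · rfl
      · exact absurd hx' (h.not_E_of_mem_N hyN)
    · exact h.owner_eq hx'N ((h.E_iff _ _).1 hy).1 hx'
  exact ((h.F_iff _ _).1 hxy').ne h.nodup_fst he

theorem isFrontier (h : Γ.IsComb P) : Γ.IsFrontier (P.map Prod.snd) :=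
  ⟨h.nodup_snd, fun n => (h.isTerminal_iff n).symm,
    (List.isChain_adj _).imp fun _ _ => h.immSucc_of_adj⟩

/-- The frontier of a comb is unique. -/
theorem frontier_eq (h : Γ.IsComb P) {w : List ℕ} (hw : Γ.IsFrontier w) :
    w = P.map Prod.snd := by
  have hmem : ∀ n, n ∈ w ↔ n ∈ P.map Prod.snd := fun n =>
    (hw.2.1 n).trans (h.isTerminal_iff n)
  refine List.Perm.eq_of_isChain_adj h.nodup_snd
    ((List.perm_ext_iff_of_nodup hw.1 h.nodup_snd).2 hmem) ?_
  exact List.IsChain.imp_of_mem_imp (fun m n hm hn hs =>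
    h.adj_of_succ ((hmem m).1 hm) ((hmem n).1 hn) hs.1) hw.2.2

/-- The labels along the frontier of a comb. -/
theorem isYield_iff (h : Γ.IsComb P) (y : List (V ⊕ α)) :
    Γ.IsYield y ↔ y = P.map fun p => Γ.label p.2 := by
  have e : (P.map Prod.snd).map Γ.label = P.map fun p => Γ.label p.2 := List.map_map
  constructor
  · rintro ⟨w, hw, rfl⟩
    rw [h.frontier_eq hw, e]
  · rintro rfl
    exact ⟨_, h.isFrontier, e.symm⟩

theorem isSymbolYield_iff (h : Γ.IsComb P) {u : List α} {γ : List V}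
    (hy : (P.map fun p => Γ.label p.2) = u.map Sum.inr ++ γ.map Sum.inl) (v : List α) :
    Γ.IsSymbolYield v ↔ v = u := by
  have e : (u.map Sum.inr ++ γ.map Sum.inl : List (V ⊕ α)).filterMap Sum.getRight? = u := by
    rw [List.filterMap_append, List.filterMap_map, List.filterMap_map]
    simp [Function.comp_def]
  constructor
  · rintro ⟨y, hy', rfl⟩
    rw [(h.isYield_iff y).1 hy', hy, e]
  · rintro rfl
    exact ⟨_, (h.isYield_iff _).2 rfl, by rw [hy, e]⟩

theorem not_isDownPath (h : Γ.IsComb P) {t : ℕ} (ht : t ∈ Γ.N) : ¬ Γ.IsDownPath t := by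
  rintro ⟨s, hE, hp⟩
  rcases hp.cases_head with rfl | ⟨c, hc, _⟩
  · exact h.not_E_of_mem_N ht hE
  · have hs : s ∈ Γ.N := hc.elim (fun hc => (Γ.E_mem _ _ hc).1) fun hc => (Γ.F_mem _ _ hc).1
    exact h.not_E_of_mem_N hs hE

theorem isRightPath (h : Γ.IsComb P) {t : ℕ} (ht : t ∈ Γ.N) (hne : t ≠ Γ.root) :
    Γ.IsRightPath t := by
  have hr : Γ.Path Γ.root t := Γ.reachable t (Finset.mem_union_left _ ht)
  rcases hr.cases_head with he | ⟨c, hc | hc, hp⟩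
  · exact absurd he.symm hne
  · exact absurd ⟨c, hc, hp⟩ (h.not_isDownPath ht)
  · exact ⟨c, hc, hp⟩

theorem of_isSingle {A : V} (h : Γ.IsSingle A) : Γ.IsComb [(Γ.root, Γ.root)] where
  nodup_fst := by simp
  nodup_snd := by simp
  mem_N n := by simp [h.1]
  mem_L n := by simp +contextual [h.2.1, eq_comm]
  root := rfl
  E_iff m n := by
    refine ⟨fun hE => ?_, by simp +contextual⟩
    have hn := (Γ.E_mem m n hE).2
    rw [h.1, h.2.1, Finset.union_empty, Finset.mem_singleton] at hn
    exact absurd (hn ▸ hE) (Γ.root_top m).1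
  F_iff m n := by
    refine ⟨fun hF => ?_, by simp [List.Adj]⟩
    have hn := (Γ.F_mem m n hF).2
    rw [h.1, Finset.mem_singleton] at hn
    exact absurd (hn ▸ hF) (Γ.root_top m).2

/-- A copy of a comb is a comb. -/
theorem copy (h : Γ.IsComb P) {f : ℕ → ℕ} {Γ' : ParseGraph V α} (hf : IsCopy f Γ Γ') :
    Γ'.IsComb (P.map (Prod.map f f)) := by
  have hfst : (P.map (Prod.map f f)).map Prod.fst = (P.map Prod.fst).map f := by simp
  have hsnd : (P.map (Prod.map f f)).map Prod.snd = (P.map Prod.snd).map f := by simp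
  have hinj : Set.InjOn f (Γ.N ∪ Γ.L : Finset ℕ) := by
    rw [Finset.coe_union, Set.injOn_union (by exact_mod_cast Γ.disjoint)]
    refine ⟨hf.bij_N.injOn, hf.bij_L.injOn, fun m hm n hn he => ?_⟩
    exact Finset.disjoint_left.1 Γ'.disjoint (hf.bij_N.mapsTo hm) (he ▸ hf.bij_L.mapsTo hn)
  have hmemN : ∀ n ∈ Γ.N, n ∈ Γ.N ∪ Γ.L := fun n hn => Finset.mem_union_left _ hn
  have hsurj : ∀ n ∈ Γ'.N ∪ Γ'.L, ∃ m ∈ Γ.N ∪ Γ.L, f m = n := by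
    intro n hn
    rcases Finset.mem_union.1 hn with hn | hn
    · obtain ⟨m, hm, rfl⟩ := hf.bij_N.surjOn hn
      exact ⟨m, Finset.mem_union_left _ hm, rfl⟩
    · obtain ⟨m, hm, rfl⟩ := hf.bij_L.surjOn hn
      exact ⟨m, Finset.mem_union_right _ hm, rfl⟩
  have hpair : ∀ m n, (m, n) ∈ P.map (Prod.map f f) ∧ m ≠ n ↔
      ∃ m' n', ((m', n') ∈ P ∧ m' ≠ n') ∧ f m' = m ∧ f n' = n := by
    intro m n
    constructor
    · rintro ⟨hp, hne⟩
      obtain ⟨⟨m', n'⟩, hP, he⟩ := List.mem_map.1 hp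
      obtain ⟨rfl, rfl⟩ := Prod.mk.inj he
      exact ⟨m', n', ⟨hP, fun he => hne (he ▸ rfl)⟩, rfl, rfl⟩
    · rintro ⟨m', n', ⟨hp, hne⟩, rfl, rfl⟩
      exact ⟨List.mem_map.2 ⟨_, hp, rfl⟩, fun he =>
        hne (hinj (hmemN _ (h.fst_mem_N hp)) (h.snd_mem hp) he)⟩
  refine ⟨?_, ?_, fun n => ?_, fun n => ?_, ?_, fun m n => ?_, fun m n => ?_⟩
  · rw [hfst]
    refine h.nodup_fst.map_on fun x hx y hy => hinj ?_ ?_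
    · exact hmemN _ ((h.mem_N x).2 hx)
    · exact hmemN _ ((h.mem_N y).2 hy)
  · rw [hsnd]
    refine h.nodup_snd.map_on fun x hx y hy => hinj ?_ ?_
    · exact ((h.isTerminal_iff x).2 hx).1
    · exact ((h.isTerminal_iff y).2 hy).1
  · rw [hfst, List.mem_map, ← Finset.mem_coe, ← hf.bij_N.image_eq]
    simp only [Set.mem_image, Finset.mem_coe, h.mem_N]
  · simp only [hpair]
    rw [← Finset.mem_coe, ← hf.bij_L.image_eq]
    simp only [Set.mem_image, Finset.mem_coe, h.mem_L]
    constructor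
    · rintro ⟨n', ⟨m', hp⟩, rfl⟩
      exact ⟨f m', m', n', hp, rfl, rfl⟩
    · rintro ⟨_, m', n', hp, rfl, rfl⟩
      exact ⟨n', ⟨m', hp⟩, rfl⟩
  · rw [hfst, List.head?_map, h.root, Option.map_some, hf.root]
  · rw [hpair]
    constructor
    · intro hE
      obtain ⟨m', hm', rfl⟩ := hsurj m (Finset.mem_union_left _ (Γ'.E_mem _ _ hE).1)
      obtain ⟨n', hn', rfl⟩ := hsurj n (Γ'.E_mem _ _ hE).2
      exact ⟨m', n', (h.E_iff _ _).1 ((hf.E _ hm' _ hn').1 hE), rfl, rfl⟩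
    · rintro ⟨m', n', hp, rfl, rfl⟩
      have hE := (h.E_iff _ _).2 hp
      exact (hf.E _ (hmemN _ (Γ.E_mem _ _ hE).1) _ (Γ.E_mem _ _ hE).2).2 hE
  · rw [hfst, List.adj_map]
    constructor
    · intro hF
      obtain ⟨m', hm', rfl⟩ := hsurj m (Finset.mem_union_left _ (Γ'.F_mem _ _ hF).1)
      obtain ⟨n', hn', rfl⟩ := hsurj n (Finset.mem_union_left _ (Γ'.F_mem _ _ hF).2)
      exact ⟨m', n', (h.F_iff _ _).1 ((hf.F _ hm' _ hn').1 hF), rfl, rfl⟩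
    · rintro ⟨m', n', hp, rfl, rfl⟩
      have hF := (h.F_iff _ _).2 hp
      exact (hf.F _ (hmemN _ (Γ.F_mem _ _ hF).1) _ (hmemN _ (Γ.F_mem _ _ hF).2)).2 hF

/-- Every comb has copies whose nodes are arbitrarily large. -/
theorem exists_copy (h : Γ.IsComb P) (K : ℕ) : ∃ Γ', IsCopy (· + K) Γ Γ' := by
  have hinj : Function.Injective (· + K) := add_left_injective K
  have hfst : (P.map (Prod.map (· + K) (· + K))).map Prod.fst
      = (P.map Prod.fst).map (· + K) := by simp
  have hsnd : (P.map (Prod.map (· + K) (· + K))).map Prod.snd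
      = (P.map Prod.snd).map (· + K) := by simp
  have hd : IsCombData (fun n => Γ.label (n - K)) (P.map (Prod.map (· + K) (· + K))) := by
    refine ⟨?_, ?_, ?_, ?_, ?_, ?_⟩
    · rintro he
      have := h.root
      rw [List.map_eq_nil_iff.1 he] at this
      simp at this
    · rw [hfst]
      exact h.nodup_fst.map hinj
    · rw [hsnd]
      exact h.nodup_snd.map hinj
    · rw [hfst]
      intro p hp hne
      obtain ⟨⟨m, n⟩, hP, rfl⟩ := List.mem_map.1 hp
      rw [Prod.map_snd, List.mem_map_of_injective hinj, ← h.mem_N]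
      exact h.not_mem_N_of_ne hP fun he => hne (congrArg (· + K) he)
    · intro p hp
      obtain ⟨⟨m, n⟩, hP, rfl⟩ := List.mem_map.1 hp
      simpa using Γ.label_N m (h.fst_mem_N hP)
    · intro p hp hne
      obtain ⟨⟨m, n⟩, hP, rfl⟩ := List.mem_map.1 hp
      simpa using Γ.label_L n ((h.mem_L n).2 ⟨m, hP, fun he => hne (congrArg (· + K) he)⟩)
  have hc := isComb_ofComb hd
  have hpair : ∀ m n, (m + K, n + K) ∈ P.map (Prod.map (· + K) (· + K)) ↔ (m, n) ∈ P := by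
    intro m n
    simp
  refine ⟨ofComb _ _ hd, ⟨?_, ?_, ?_, ?_, ?_, ?_⟩⟩
  · refine ⟨fun n hn => ?_, hinj.injOn, fun n hn => ?_⟩
    · rw [Finset.mem_coe, hc.mem_N, hfst]
      exact List.mem_map_of_mem ((h.mem_N n).1 hn)
    · rw [Finset.mem_coe, hc.mem_N, hfst] at hn
      obtain ⟨m, hm, rfl⟩ := List.mem_map.1 hn
      exact ⟨m, (h.mem_N m).2 hm, rfl⟩
  · refine ⟨fun n hn => ?_, hinj.injOn, fun n hn => ?_⟩
    · obtain ⟨m, hm, hne⟩ := (h.mem_L n).1 hn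
      exact (hc.mem_L _).2 ⟨m + K, (hpair m n).2 hm, fun he => hne (hinj he)⟩
    · obtain ⟨m, hm, hne⟩ := (hc.mem_L _).1 hn
      obtain ⟨⟨m', n'⟩, hp, he⟩ := List.mem_map.1 hm
      obtain ⟨rfl, rfl⟩ := Prod.mk.inj he
      exact ⟨n', (h.mem_L _).2 ⟨m', hp, fun he => hne (congrArg (· + K) he)⟩, rfl⟩
  · have := hc.root
    rw [hfst, List.head?_map, h.root, Option.map_some, Option.some_inj] at this
    exact this
  · intro n _
    exact congrArg Γ.label (Nat.add_sub_cancel n K)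
  · intro m _ n _
    rw [hc.E_iff, h.E_iff, hpair, Ne, Nat.add_right_cancel_iff]
  · intro m _ n _
    rw [hc.F_iff, h.F_iff, hfst, List.adj_map]
    constructor
    · rintro ⟨m', n', hA, hm, hn⟩
      rwa [← hinj hm, ← hinj hn]
    · exact fun hA => ⟨m, n, hA, rfl, rfl⟩

end IsComb

end ParseGraph

/-! ### Interpolation of combs -/

namespace ParseGraph

variable {V α : Type*} {Γ₁ Γ₂ Γ₃ : ParseGraph V α} {X Y Z : List (ℕ × ℕ)} {q t : ℕ}

namespace IsComb

theorem label_eq_inl_of_mem_N {A : V} {Γ : ParseGraph V α} {P : List (ℕ × ℕ)} (h : Γ.IsComb P)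
    {p : ℕ × ℕ} (hp : p ∈ P) (hl : Γ.label p.2 = Sum.inl A) : p.2 ∈ Γ.N := by
  rcases Finset.mem_union.1 (h.snd_mem hp) with hN | hL
  · exact hN
  · obtain ⟨a, ha⟩ := Γ.label_L _ hL
    simp [ha] at hl

theorem label_eq_inr_mem_L {a : α} {Γ : ParseGraph V α} {P : List (ℕ × ℕ)} (h : Γ.IsComb P)
    {p : ℕ × ℕ} (hp : p ∈ P) (hl : Γ.label p.2 = Sum.inr a) : p.2 ∈ Γ.L := by
  rcases Finset.mem_union.1 (h.snd_mem hp) with hN | hL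
  · obtain ⟨A, hA⟩ := Γ.label_N _ hN
    simp [hA] at hl
  · exact hL

/-- The edge condition of an interpolation at a terminal anchor `q` of a comb describes the child
edges of the comb in which the addendum replaces `q`. -/
theorem interpolation_E_iff (h₁ : Γ₁.IsComb (X ++ (q, q) :: Y)) (h₂ : Γ₂.IsComb Z)
    (m n : ℕ) :
    ((m, n) ∈ X ++ Z ++ Y ∧ m ≠ n) ↔
      (Γ₁.E m n ∧ m ≠ q ∧ n ≠ q) ∨ Γ₂.E m n ∨ (Γ₁.E m q ∧ n = Γ₂.root) ∨
      (Γ₁.E q n ∧ ((Γ₂.IsDownPath t ∧ m = t) ∨ (¬ Γ₂.IsDownPath t ∧ m = Γ₂.root))) := by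
  have hqP : (q, q) ∈ X ++ (q, q) :: Y := by simp
  have hqN : q ∈ Γ₁.N := h₁.fst_mem_N hqP
  have hin : ∀ m, ¬ Γ₁.E m q := fun m => h₁.not_E_of_mem_N hqN
  have hout : ∀ n, ¬ Γ₁.E q n := fun n hE =>
    ((h₁.E_iff q n).1 hE).2 (pair_eq_of_fst h₁.nodup_fst hqP ((h₁.E_iff q n).1 hE).1)
  have h1 : Γ₁.E m n → m ≠ q ∧ n ≠ q :=
    fun hE => ⟨by rintro rfl; exact hout _ hE, by rintro rfl; exact hin _ hE⟩
  have h3 : ((m, n) ∈ X ∨ (m, n) ∈ Y) ∧ m ≠ n ↔ Γ₁.E m n := by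
    rw [h₁.E_iff, List.mem_append, List.mem_cons, Prod.mk.injEq]
    refine ⟨fun ⟨h, hne⟩ => ⟨h.imp_right .inr, hne⟩, fun ⟨h, hne⟩ => ⟨?_, hne⟩⟩
    rcases h with h | ⟨rfl, rfl⟩ | h
    · exact .inl h
    · exact absurd rfl hne
    · exact .inr h
  rw [h₂.E_iff, List.mem_append, List.mem_append, ← h3]
  rw [← h3] at h1
  have h4 := hin m
  have h5 := hout n
  tauto

/-- The edge condition of an interpolation at a terminal anchor `q`, with the last node of the
addendum's spine as the target, describes the sibling edges of the comb in which the addendum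
replaces `q`. -/
theorem interpolation_F_iff (h₁ : Γ₁.IsComb (X ++ (q, q) :: Y)) (h₂ : Γ₂.IsComb Z)
    (ht : (Z.map Prod.fst).getLast? = some t) (m n : ℕ) :
    ((X ++ Z ++ Y).map Prod.fst).Adj m n ↔
      (Γ₁.F m n ∧ m ≠ q ∧ n ≠ q) ∨ Γ₂.F m n ∨ (Γ₁.F m q ∧ n = Γ₂.root) ∨
      (Γ₁.F q n ∧ ((Γ₂.IsRightPath t ∧ m = t) ∨ (¬ Γ₂.IsRightPath t ∧ m = Γ₂.root))) := by
  have htN : t ∈ Γ₂.N := (h₂.mem_N t).2 (List.mem_of_mem_getLast? ht)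
  -- If the path to the target is empty, then the root and the target are the same node.
  have hlast : ((Γ₂.IsRightPath t ∧ m = t) ∨ (¬ Γ₂.IsRightPath t ∧ m = Γ₂.root)) ↔ m = t := by
    by_cases hr : Γ₂.IsRightPath t
    · simp [hr]
    · have he : t = Γ₂.root := by_contra fun hne => hr (h₂.isRightPath htN hne)
      simp [hr, ← he]
  have hn := h₁.nodup_fst
  rw [List.map_append, List.map_cons] at hn
  rw [hlast, h₁.F_iff, h₁.F_iff, h₁.F_iff, h₂.F_iff, List.map_append, List.map_append,
    List.map_append, List.map_cons]
  exact List.adj_replace_iff hn h₂.root ht m n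

theorem interpolation_nodup {f : ℕ × ℕ → ℕ} (h₁ : ((X ++ (q, q) :: Y).map f).Nodup)
    (h₂ : (Z.map f).Nodup) (hd : ∀ p ∈ X ++ (q, q) :: Y, ∀ r ∈ Z, f p ≠ f r) :
    ((X ++ Z ++ Y).map f).Nodup := by
  simp only [List.map_append, List.map_cons, List.nodup_append, List.nodup_cons, List.mem_append,
    List.mem_cons, List.mem_map] at h₁ ⊢
  refine ⟨⟨h₁.1, h₂, ?_⟩, h₁.2.1.2, ?_⟩
  · rintro _ ⟨p, hp, rfl⟩ _ ⟨r, hr, rfl⟩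
    exact hd p (by simp [hp]) r hr
  · rintro _ (⟨p, hp, rfl⟩ | ⟨p, hp, rfl⟩) _ ⟨r, hr, rfl⟩ he
    · exact h₁.2.2 _ ⟨p, hp, rfl⟩ _ (.inr ⟨r, hr, rfl⟩) he
    · exact hd r (by simp [hr]) p hp he.symm

theorem interpolation_nodup_fst (h₁ : Γ₁.IsComb (X ++ (q, q) :: Y)) (h₂ : Γ₂.IsComb Z)
    (hd : Disjoint (Γ₁.N ∪ Γ₁.L) (Γ₂.N ∪ Γ₂.L)) : ((X ++ Z ++ Y).map Prod.fst).Nodup := by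
  refine interpolation_nodup h₁.nodup_fst h₂.nodup_fst fun p hp r hr he => ?_
  refine Finset.disjoint_left.1 hd (Finset.mem_union_left _ (h₁.fst_mem_N hp)) ?_
  rw [he]
  exact Finset.mem_union_left _ (h₂.fst_mem_N hr)

theorem interpolation_nodup_snd (h₁ : Γ₁.IsComb (X ++ (q, q) :: Y)) (h₂ : Γ₂.IsComb Z)
    (hd : Disjoint (Γ₁.N ∪ Γ₁.L) (Γ₂.N ∪ Γ₂.L)) : ((X ++ Z ++ Y).map Prod.snd).Nodup := by
  refine interpolation_nodup h₁.nodup_snd h₂.nodup_snd fun p hp r hr he => ?_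
  refine Finset.disjoint_left.1 hd (h₁.snd_mem hp) ?_
  rw [he]
  exact h₂.snd_mem hr

theorem interpolation_mem_N (h₁ : Γ₁.IsComb (X ++ (q, q) :: Y)) (h₂ : Γ₂.IsComb Z) (n : ℕ) :
    n ∈ (Γ₁.N \ {q}) ∪ Γ₂.N ↔ n ∈ (X ++ Z ++ Y).map Prod.fst := by
  have hn := h₁.nodup_fst
  rw [List.map_append, List.map_cons, List.nodup_append, List.nodup_cons] at hn
  have hX : n ∈ X.map Prod.fst → n ≠ q := fun h => hn.2.2 n h q (by simp)
  have hY : n ∈ Y.map Prod.fst → n ≠ q := fun h e => hn.2.1.1 (e ▸ h)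
  rw [Finset.mem_union, Finset.mem_sdiff, h₁.mem_N, h₂.mem_N, Finset.mem_singleton,
    List.map_append, List.map_append, List.map_append, List.map_cons, List.mem_append,
    List.mem_append, List.mem_append, List.mem_cons]
  tauto

theorem interpolation_mem_L (h₁ : Γ₁.IsComb (X ++ (q, q) :: Y)) (h₂ : Γ₂.IsComb Z) (n : ℕ) :
    n ∈ Γ₁.L ∪ Γ₂.L ↔ ∃ m, (m, n) ∈ X ++ Z ++ Y ∧ m ≠ n := by
  rw [Finset.mem_union, h₁.mem_L, h₂.mem_L, ← exists_or]
  refine exists_congr fun m => ?_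
  rw [List.mem_append, List.mem_append, List.mem_append, List.mem_cons, Prod.mk.injEq]
  have : m = q ∧ n = q → m = n := fun h => h.1.trans h.2.symm
  tauto

theorem interpolation_root (h₁ : Γ₁.IsComb (X ++ (q, q) :: Y)) (h₂ : Γ₂.IsComb Z) :
    ((X ++ Z ++ Y).map Prod.fst).head? = some (if q = Γ₁.root then Γ₂.root else Γ₁.root) := by
  have hn := h₁.nodup_fst
  have hr := h₁.root
  have hs := h₂.root
  cases Z with
  | nil => simp at hs
  | cons z Z =>
    cases X with
    | nil =>
      obtain rfl : q = Γ₁.root := by simpa using hr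
      simpa using hs
    | cons x X =>
      have hx : x.1 = Γ₁.root := by simpa using hr
      have hne : q ≠ Γ₁.root := by
        rintro rfl
        rw [List.cons_append, List.map_cons, List.nodup_cons] at hn
        exact hn.1 (by simp [hx])
      simp [hne, hx]

/-- Interpolating a comb at a terminal anchor, with the last node of its spine as the target, puts
its pairs in the place of the anchor. -/
theorem interpolation (h₁ : Γ₁.IsComb (X ++ (q, q) :: Y)) (h₂ : Γ₂.IsComb Z)
    (ht : (Z.map Prod.fst).getLast? = some t) (hI : IsInterpolation Γ₁ Γ₂ q t Γ₃) :
    Γ₃.IsComb (X ++ Z ++ Y) where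
  nodup_fst := h₁.interpolation_nodup_fst h₂ hI.disjoint
  nodup_snd := h₁.interpolation_nodup_snd h₂ hI.disjoint
  mem_N n := by rw [hI.N_eq, h₁.interpolation_mem_N h₂]
  mem_L n := by rw [hI.L_eq, h₁.interpolation_mem_L h₂]
  root := by rw [hI.root_eq, h₁.interpolation_root h₂]
  E_iff m n := by
    rw [hI.E_iff, h₁.interpolation_E_iff h₂]
  F_iff m n := by rw [hI.F_iff, h₁.interpolation_F_iff h₂ ht]

/-- The root of an addendum that has a child already cannot take over a child of the anchor, so the
anchor is terminal. -/
theorem anchor_pair_mem {P : List (ℕ × ℕ)} (h₁ : Γ₁.IsComb P) (h₂ : Γ₂.IsComb Z) {s a : ℕ}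
    (hs : (s, a) ∈ Z) (hsa : s ≠ a) (hroot : Γ₂.root = s) (ht : t ∈ Γ₂.N)
    (hI : IsInterpolation Γ₁ Γ₂ q t Γ₃) : (q, q) ∈ P := by
  obtain ⟨⟨q, n⟩, hP, rfl⟩ := List.mem_map.1 ((h₁.mem_N q).1 hI.anchor)
  by_cases hne : q = n
  · rwa [← hne] at hP
  · exfalso
    have hE : Γ₁.E q n := (h₁.E_iff q n).2 ⟨hP, hne⟩
    have hE₂ : Γ₂.E s a := (h₂.E_iff s a).2 ⟨hs, hsa⟩
    have e1 : Γ₃.E s n := (hI.E_iff s n).2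
      (.inr (.inr (.inr ⟨hE, .inr ⟨h₂.not_isDownPath ht, hroot.symm⟩⟩)))
    have e2 : Γ₃.E s a := (hI.E_iff s a).2 (.inr (.inl hE₂))
    obtain rfl := Γ₃.E_fun _ _ _ e1 e2
    exact Finset.disjoint_left.1 hI.disjoint (Γ₁.E_mem _ _ hE).2 (Γ₂.E_mem _ _ hE₂).2

/-- The frontier constraint forces the anchor to be the leftmost nonlexical node of the frontier:
everything before it is a lexeme. -/
theorem mem_L_of_interpolation {s a : ℕ} {bs : List (ℕ × ℕ)} (h₁ : Γ₁.IsComb (X ++ (q, q) :: Y))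
    (h₂ : Γ₂.IsComb ((s, a) :: bs)) (hbs : ∀ p ∈ bs, p.1 = p.2)
    (ht : (((s, a) :: bs).map Prod.fst).getLast? = some t)
    (hI : IsInterpolation Γ₁ Γ₂ q t Γ₃) : ∀ p ∈ X, p.2 ∈ Γ₁.L := by
  obtain ⟨x, ξ, δ, β, w₃, a', hF₁, hx, _, _, ha', _, _, hF₃, hpre⟩ := hI.frontier
  have h₃ := h₁.interpolation h₂ ht hI
  obtain rfl : a' = a := by
    obtain ⟨m, hm, hne⟩ := (h₂.mem_L a').1 ha'
    rcases List.mem_cons.1 hm with hm | hm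
    · exact (Prod.mk.inj hm).2
    · exact absurd (hbs _ hm) hne
  have e₁ := h₁.frontier_eq hF₁
  have e₃ := h₃.frontier_eq hF₃
  rw [e₃] at hpre
  have hnot : ∀ n ∈ x, n ≠ a' := by
    rintro n hn rfl
    exact Finset.disjoint_left.1 hI.disjoint (Finset.mem_union_right _ (hx _ hn))
      (Finset.mem_union_right _ ha')
  -- The lexeme occurs only once in the new frontier, so `x` and `X` have the same length.
  have hXx : X.map Prod.snd = x := by
    obtain ⟨v, hv⟩ := hpre
    have hnd := h₃.nodup_snd
    have he : X.map Prod.snd ++ a' :: (bs ++ Y).map Prod.snd = x ++ a' :: v := by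
      simpa using hv.symm
    have hnd' : (X.map Prod.snd ++ a' :: (bs ++ Y).map Prod.snd).Nodup := by simpa using hnd
    have hX : a' ∉ X.map Prod.snd := fun h =>
      (List.nodup_append.1 hnd').2.2 _ h a' (by simp) rfl
    have i1 := List.idxOf_append_of_notMem (l₂ := a' :: (bs ++ Y).map Prod.snd) hX
    have i2 := List.idxOf_append_of_notMem (l₂ := a' :: v) (fun h => hnot a' h rfl)
    rw [he, i2, List.idxOf_cons_self, List.idxOf_cons_self] at i1
    exact (List.append_inj he (by omega)).1
  intro p hp
  exact hx _ (hXx ▸ List.mem_map_of_mem hp)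

/-- The converse: a comb can be interpolated at the leftmost nonlexical node of the frontier. -/
theorem isInterpolation {s a : ℕ} {bs : List (ℕ × ℕ)} (h₁ : Γ₁.IsComb (X ++ (q, q) :: Y))
    (h₂ : Γ₂.IsComb ((s, a) :: bs)) (h₃ : Γ₃.IsComb (X ++ ((s, a) :: bs) ++ Y)) (hsa : s ≠ a)
    (hbs : ∀ p ∈ bs, p.1 = p.2) (ht : (((s, a) :: bs).map Prod.fst).getLast? = some t)
    (hd : Disjoint (Γ₁.N ∪ Γ₁.L) (Γ₂.N ∪ Γ₂.L))
    (hX : ∀ p ∈ X, p.2 ∈ Γ₁.L) (hY : ∀ p ∈ Y, p.2 ∈ Γ₁.N)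
    (hl₁ : ∀ n ∈ (Γ₁.N \ {q}) ∪ Γ₁.L, Γ₃.label n = Γ₁.label n)
    (hl₂ : ∀ n ∈ Γ₂.N ∪ Γ₂.L, Γ₃.label n = Γ₂.label n) :
    IsInterpolation Γ₁ Γ₂ q t Γ₃ := by
  have htN : t ∈ Γ₂.N := (h₂.mem_N t).2 (List.mem_of_mem_getLast? ht)
  have hqN : q ∈ Γ₁.N := h₁.fst_mem_N (p := (q, q)) (by simp)
  have haL : ∀ n, n ∈ Γ₂.L ↔ n = a := by
    intro n
    rw [h₂.mem_L]
    constructor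
    · rintro ⟨m, hm, hne⟩
      rcases List.mem_cons.1 hm with hm | hm
      · exact (Prod.mk.inj hm).2
      · exact absurd (hbs _ hm) hne
    · rintro rfl
      exact ⟨s, by simp, hsa⟩
  refine ⟨hqN, Finset.mem_union_left _ htN, Γ₂.reachable t (Finset.mem_union_left _ htN), hd,
    ?_, ?_, ?_, ?_, hl₁, hl₂, fun m n => ?_, fun m n => ?_, ?_⟩
  · exact Finset.card_eq_one.2 ⟨a, Finset.ext fun n => (haL n).trans Finset.mem_singleton.symm⟩
  · exact Finset.ext fun n => (h₃.mem_N n).trans (h₁.interpolation_mem_N h₂ n).symm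
  · exact Finset.ext fun n => (h₃.mem_L n).trans (h₁.interpolation_mem_L h₂ n).symm
  · exact Option.some_injective _ (h₃.root.symm.trans (h₁.interpolation_root h₂))
  · rw [h₃.E_iff, h₁.interpolation_E_iff h₂]
  · rw [h₃.F_iff, h₁.interpolation_F_iff h₂ ht]
  · refine ⟨X.map Prod.snd, q :: Y.map Prod.snd, [], bs.map Prod.snd, _, a, ?_, ?_, ?_,
      h₂.isFrontier, (haL a).2 rfl, by simp, ?_, h₃.isFrontier, ?_⟩
    · simpa using h₁.isFrontier
    · intro n hn
      obtain ⟨p, hp, rfl⟩ := List.mem_map.1 hn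
      exact hX p hp
    · intro n hn
      rcases List.mem_cons.1 hn with rfl | hn
      · exact hqN
      · obtain ⟨p, hp, rfl⟩ := List.mem_map.1 hn
        exact hY p hp
    · intro n hn
      obtain ⟨p, hp, rfl⟩ := List.mem_map.1 hn
      rw [← hbs p hp]
      exact h₂.fst_mem_N (List.mem_cons_of_mem _ hp)
    · exact ⟨(bs ++ Y).map Prod.snd, by simp⟩

end IsComb

end ParseGraph

/-! ### The grammar of a Greibach system -/

namespace Greibach

open ParseGraph

variable {V α : Type*}

/-- Spine and teeth of the addendum for a production with `k` variables on its right-hand side: the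
root `0` with the lexeme `1`, followed by the siblings `2, …, k + 1`. -/
def addendumPairs (k : ℕ) : List (ℕ × ℕ) :=
  (0, 1) :: (List.range k).map fun i => (i + 2, i + 2)

/-- The labels of the addendum for the production `A → a Bs`. -/
def addendumLabel (A : V) (a : α) (Bs : List V) : ℕ → V ⊕ α
  | 0 => .inl A
  | 1 => .inr a
  | i + 2 => .inl (Bs.getD i A)

theorem isCombData_addendum (A : V) (a : α) (Bs : List V) :
    IsCombData (addendumLabel A a Bs) (addendumPairs Bs.length) := by
  have hinj : Function.Injective fun i : ℕ => i + 2 := add_left_injective 2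
  have hr : ((List.range Bs.length).map fun i => i + 2).Nodup := List.nodup_range.map hinj
  refine ⟨by simp [addendumPairs], ?_, ?_, ?_, ?_, ?_⟩
  · simpa [addendumPairs, Function.comp_def] using hr
  · simpa [addendumPairs, Function.comp_def] using hr
  · intro p hp hne
    rcases List.mem_cons.1 hp with rfl | hp
    · simp [addendumPairs]
    · obtain ⟨i, _, rfl⟩ := List.mem_map.1 hp
      exact absurd rfl hne
  · intro p hp
    rcases List.mem_cons.1 hp with rfl | hp
    · exact ⟨A, rfl⟩
    · obtain ⟨i, _, rfl⟩ := List.mem_map.1 hp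
      exact ⟨_, rfl⟩
  · intro p hp hne
    rcases List.mem_cons.1 hp with rfl | hp
    · exact ⟨a, rfl⟩
    · obtain ⟨i, _, rfl⟩ := List.mem_map.1 hp
      exact absurd rfl hne

/-- The addendum for the production `A → a Bs`: the root, labelled `A`, has the lexeme `a` as its
only child and nodes labelled by `Bs` as its right siblings. -/
def addendum (A : V) (a : α) (Bs : List V) : ParseGraph V α :=
  ofComb _ _ (isCombData_addendum A a Bs)

theorem isComb_addendum (A : V) (a : α) (Bs : List V) :
    (addendum A a Bs).IsComb (addendumPairs Bs.length) :=
  isComb_ofComb _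

/-- The last node of the spine of the addendum. -/
def addendumTarget (k : ℕ) : ℕ :=
  ((addendumPairs k).map Prod.fst).getLast (by simp [addendumPairs])

theorem getLast?_addendum (k : ℕ) :
    ((addendumPairs k).map Prod.fst).getLast? = some (addendumTarget k) :=
  List.getLast?_eq_some_getLast _

theorem map_label_addendum (A : V) (a : α) (Bs : List V) :
    ((addendumPairs Bs.length).map fun p => (addendum A a Bs).label p.2)
      = Sum.inr a :: Bs.map Sum.inl := by
  rw [addendumPairs, List.map_cons, List.map_map, List.cons_eq_cons]
  refine ⟨rfl, List.ext_getElem (by simp) fun i h _ => ?_⟩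
  have hi : i < Bs.length := by simpa using h
  simp [addendum, ofComb, addendumLabel, hi]

/-- The interpolation rule for the production `A → a Bs`. -/
def interpolationRule (ρ : V × α × List V) : InterpolationRule V α where
  pattern := ρ.1
  addendum := addendum ρ.1 ρ.2.1 ρ.2.2
  target := addendumTarget ρ.2.2.length
  target_mem := Finset.mem_union_left _ <| ((isComb_addendum _ _ _).mem_N _).2 <|
    List.mem_of_mem_getLast? (getLast?_addendum _)

/-- The graph interpolation grammar of a finite Greibach system. -/
def toGrammar {V : Type} [Finite V] (S : V) (R : Set (V × α × List V)) (hR : R.Finite) :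
    GraphInterpolationGrammar α where
  V := V
  finite_V := inferInstance
  rules := interpolationRule '' R
  finite_rules := hR.image _
  start := S

/-- `Represents Γ P u γ`: the comb `Γ` has yield `u γ`; it stands for the situation in which the
system has read `u` and has the stack `γ`. -/
structure Represents (Γ : ParseGraph V α) (P : List (ℕ × ℕ)) (u : List α) (γ : List V) :
    Prop where
  isComb : Γ.IsComb P
  yield : (P.map fun p => Γ.label p.2) = u.map Sum.inr ++ γ.map Sum.inl

/-- The shape and the labels of a copy of an addendum. -/
theorem exists_of_isCopy {A : V} {a : α} {Bs : List V} {f : ℕ → ℕ} {Γ₂ : ParseGraph V α}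
    (hf : IsCopy f (addendum A a Bs) Γ₂) :
    ∃ bs, Γ₂.IsComb ((f 0, f 1) :: bs) ∧ f 0 ≠ f 1 ∧ (∀ p ∈ bs, p.1 = p.2) ∧
      (((f 0, f 1) :: bs).map Prod.fst).getLast? = some (f (addendumTarget Bs.length)) ∧
      Γ₂.label (f 1) = Sum.inr a ∧ (bs.map fun p => Γ₂.label p.2) = Bs.map Sum.inl := by
  have h := (isComb_addendum A a Bs).copy hf
  have hl : ∀ p ∈ addendumPairs Bs.length,
      Γ₂.label (f p.2) = (addendum A a Bs).label p.2 := fun p hp =>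
    hf.label _ ((isComb_addendum A a Bs).snd_mem hp)
  have hlabels : ((addendumPairs Bs.length).map fun p => Γ₂.label (f p.2))
      = Sum.inr a :: Bs.map Sum.inl := by
    rw [List.map_congr_left hl, map_label_addendum]
  rw [addendumPairs, List.map_cons, List.cons_eq_cons] at hlabels
  refine ⟨((List.range Bs.length).map fun i => (i + 2, i + 2)).map (Prod.map f f), h, ?_, ?_, ?_,
    hlabels.1, ?_⟩
  · intro he
    have h0 := h.fst_mem_N (p := (f 0, f 1)) (by simp [addendumPairs])
    obtain ⟨B, hB⟩ := Γ₂.label_N _ h0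
    have he : f 0 = f 1 := he
    rw [he, show Γ₂.label (f 1) = Sum.inr a from hlabels.1] at hB
    simp at hB
  · intro p hp
    simp only [List.map_map, List.mem_map] at hp
    obtain ⟨i, _, rfl⟩ := hp
    rfl
  · have := congrArg (Option.map f) (getLast?_addendum Bs.length)
    rw [← List.getLast?_map] at this
    simpa [addendumPairs, Function.comp_def] using this
  · rw [List.map_map]
    exact hlabels.2

section

variable {V : Type} [Finite V] {S : V} {R : Set (V × α × List V)} {hR : R.Finite}

/-- A move of the grammar from a graph that represents a configuration of the system simulates a
move of the system. -/
theorem Represents.exists_of_step {Γ Γ' : ParseGraph V α} {P : List (ℕ × ℕ)} {u w w' : List α}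
    {γ : List V} (h : Represents Γ P u γ) (hs : (toGrammar S R hR).Step (Γ, w) (Γ', w')) :
    ∃ A a Bs γ' P', w = a :: w' ∧ γ = A :: γ' ∧ (A, a, Bs) ∈ R ∧
      Represents Γ' P' (u ++ [a]) (Bs ++ γ') := by
  obtain ⟨b, hw, ⟨_, ⟨⟨A, a, Bs⟩, hρ, rfl⟩, f, Γ₂', q, hf', hlab', hI'⟩, v, hv, hv'⟩ := hs
  obtain ⟨Γ₂, hf, hI⟩ : ∃ Γ₂ : ParseGraph V α, IsCopy f (addendum A a Bs) Γ₂ ∧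
    IsInterpolation Γ Γ₂ q (f (addendumTarget Bs.length)) Γ' := ⟨Γ₂', hf', hI'⟩
  have hlab : Γ.label q = Sum.inl A := hlab'
  obtain ⟨bs, h₂, hne, hbs, ht, hla, hlbs⟩ := exists_of_isCopy hf
  have hroot : Γ₂.root = f 0 := by simpa using h₂.root.symm
  have hqP := h.isComb.anchor_pair_mem h₂ (by simp) hne hroot
    ((h₂.mem_N _).2 (List.mem_of_mem_getLast? ht)) hI
  obtain ⟨X, Y, rfl⟩ := List.append_of_mem hqP
  have hX := h.isComb.mem_L_of_interpolation h₂ hbs ht hI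
  have h₃ := h.isComb.interpolation h₂ ht hI
  have hy := h.yield
  rw [List.map_append, List.map_cons, hlab] at hy
  obtain ⟨hyX, hyY⟩ := List.eq_map_of_append_inl_cons (by
    intro x hx
    obtain ⟨p, hp, rfl⟩ := List.mem_map.1 hx
    exact Γ.label_L _ (hX p hp)) hy
  have hnd := h.isComb.nodup_snd
  rw [List.map_append, List.map_cons, List.nodup_append, List.nodup_cons] at hnd
  -- Nodes other than the anchor keep their labels.
  have hkeep : ∀ p ∈ X ++ Y, Γ'.label p.2 = Γ.label p.2 := by
    intro p hp
    refine hI.label_left _ ?_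
    have hmem : p ∈ X ++ (q, q) :: Y := by
      rcases List.mem_append.1 hp with hp | hp <;> simp [hp]
    have hpq : p.2 ≠ q := by
      rcases List.mem_append.1 hp with hp | hp
      · exact hnd.2.2 _ (List.mem_map_of_mem hp) q (by simp)
      · exact fun e => hnd.2.1.1 (List.mem_map.2 ⟨p, hp, e⟩)
    rcases Finset.mem_union.1 (h.isComb.snd_mem hmem) with hN | hL
    · simp [hN, hpq]
    · simp [hL]
  have hkeep₂ : ∀ p ∈ (f 0, f 1) :: bs, Γ'.label p.2 = Γ₂.label p.2 := fun p hp =>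
    hI.label_right _ (h₂.snd_mem hp)
  cases γ with
  | nil => simp at hyY
  | cons A' γ =>
    rw [List.map_cons, List.cons_eq_cons] at hyY
    obtain rfl := Sum.inl_injective hyY.1
    have hy' : ((X ++ (f 0, f 1) :: bs ++ Y).map fun p => Γ'.label p.2)
        = (u ++ [a]).map Sum.inr ++ (Bs ++ γ).map Sum.inl := by
      rw [List.map_append, List.map_append, List.map_congr_left hkeep₂,
        List.map_congr_left fun p hp => hkeep p (List.mem_append_left _ hp),
        List.map_congr_left fun p hp => hkeep p (List.mem_append_right _ hp), hyX, hyY.2,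
        List.map_cons, hlbs, hla]
      simp
    have hvu := (h.isComb.isSymbolYield_iff h.yield v).1 hv
    have hvu' := (h₃.isSymbolYield_iff hy' _).1 hv'
    rw [hvu, List.append_cancel_left_eq, List.cons_eq_cons] at hvu'
    obtain rfl := hvu'.1
    exact ⟨A, b, Bs, γ, _, hw, rfl, hρ, h₃, hy'⟩

/-- A move of the system is simulated by a move of the grammar. -/
theorem Represents.exists_step {Γ : ParseGraph V α} {P : List (ℕ × ℕ)} {u : List α} {A : V} {a : α}
    {Bs γ : List V} (h : Represents Γ P u (A :: γ)) (hρ : (A, a, Bs) ∈ R) (w : List α) :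
    ∃ Γ' P', (toGrammar S R hR).Step (Γ, a :: w) (Γ', w) ∧
      Represents Γ' P' (u ++ [a]) (Bs ++ γ) := by
  obtain ⟨X, Y₀, rfl, hyX, hyY₀⟩ := List.map_eq_append_iff.1 h.yield
  obtain ⟨⟨q', q⟩, Y, rfl, hlab, hyY⟩ := List.map_eq_cons_iff.1 (hyY₀.trans (List.map_cons ..))
  have hlab : Γ.label q = Sum.inl A := hlab
  have hqN : q ∈ Γ.N := h.isComb.label_eq_inl_of_mem_N (p := (q', q)) (by simp) hlab
  obtain rfl := h.isComb.eq_of_mem_N (m := q') (n := q) (by simp) hqN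
  have hX : ∀ p ∈ X, p.2 ∈ Γ.L := by
    intro p hp
    have : Γ.label p.2 ∈ u.map (Sum.inr : α → V ⊕ α) := hyX ▸ List.mem_map_of_mem hp
    obtain ⟨b, _, hb⟩ := List.mem_map.1 this
    exact h.isComb.label_eq_inr_mem_L (by simp [hp]) hb.symm
  have hY : ∀ p ∈ Y, p.2 ∈ Γ.N := by
    intro p hp
    have : Γ.label p.2 ∈ γ.map (Sum.inl : V → V ⊕ α) := hyY ▸ List.mem_map_of_mem hp
    obtain ⟨b, _, hb⟩ := List.mem_map.1 this
    exact h.isComb.label_eq_inl_of_mem_N (by simp [hp]) hb.symm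
  -- A copy of the addendum whose nodes are beyond all nodes of the context.
  obtain ⟨Γ₂, hf⟩ := (isComb_addendum A a Bs).exists_copy ((Γ.N ∪ Γ.L).sup id + 1)
  obtain ⟨bs, h₂, hne, hbs, ht, hla, hlbs⟩ := exists_of_isCopy hf
  set f : ℕ → ℕ := (· + ((Γ.N ∪ Γ.L).sup id + 1)) with hf_def
  have hd : Disjoint (Γ.N ∪ Γ.L) (Γ₂.N ∪ Γ₂.L) := by
    rw [Finset.disjoint_left]
    intro n hn hn₂
    have h1 : n ≤ (Γ.N ∪ Γ.L).sup id := Finset.le_sup (f := id) hn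
    have h2 : ∃ m, f m = n := by
      rcases Finset.mem_union.1 hn₂ with hn₂ | hn₂
      · obtain ⟨m, _, hm⟩ := hf.bij_N.surjOn hn₂
        exact ⟨m, hm⟩
      · obtain ⟨m, _, hm⟩ := hf.bij_L.surjOn hn₂
        exact ⟨m, hm⟩
    obtain ⟨m, rfl⟩ := h2
    simp only [hf_def] at h1
    omega
  classical
  let lab : ℕ → V ⊕ α := fun n => if n ∈ Γ₂.N ∪ Γ₂.L then Γ₂.label n else Γ.label n
  have hlab₁ : ∀ n ∈ Γ.N ∪ Γ.L, lab n = Γ.label n := fun n hn =>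
    if_neg (Finset.disjoint_left.1 hd hn)
  have hlab₂ : ∀ n ∈ Γ₂.N ∪ Γ₂.L, lab n = Γ₂.label n := fun n hn => if_pos hn
  have hmemN := h.isComb.interpolation_mem_N h₂
  have hmemL := h.isComb.interpolation_mem_L h₂
  have hlabN : ∀ n ∈ (X ++ (f 0, f 1) :: bs ++ Y).map Prod.fst, ∃ B, lab n = Sum.inl B := by
    intro n hn
    rcases Finset.mem_union.1 ((hmemN n).2 hn) with hn | hn
    · have hn := (Finset.mem_sdiff.1 hn).1
      rw [hlab₁ n (Finset.mem_union_left _ hn)]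
      exact Γ.label_N n hn
    · rw [hlab₂ n (Finset.mem_union_left _ hn)]
      exact Γ₂.label_N n hn
  have hlabL : ∀ p ∈ X ++ (f 0, f 1) :: bs ++ Y, p.1 ≠ p.2 → ∃ b, lab p.2 = Sum.inr b := by
    intro p hp hpne
    rcases Finset.mem_union.1 ((hmemL p.2).2 ⟨p.1, hp, hpne⟩) with hn | hn
    · rw [hlab₁ _ (Finset.mem_union_right _ hn)]
      exact Γ.label_L _ hn
    · rw [hlab₂ _ (Finset.mem_union_right _ hn)]
      exact Γ₂.label_L _ hn
  have hcd : IsCombData lab (X ++ (f 0, f 1) :: bs ++ Y) := by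
    refine ⟨by simp, h.isComb.interpolation_nodup_fst h₂ hd,
      h.isComb.interpolation_nodup_snd h₂ hd, ?_, ?_, hlabL⟩
    · intro p hp hpne hN
      obtain ⟨B, hB⟩ := hlabN _ hN
      obtain ⟨b, hb⟩ := hlabL p hp hpne
      rw [hB] at hb
      simp at hb
    · exact fun p hp => hlabN _ (List.mem_map_of_mem hp)
  have h₃ := isComb_ofComb hcd
  have hI : IsInterpolation Γ Γ₂ q' (f (addendumTarget Bs.length)) (ofComb _ _ hcd) := by
    refine h.isComb.isInterpolation h₂ h₃ hne hbs ht hd hX hY (fun n hn => hlab₁ n ?_) hlab₂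
    rcases Finset.mem_union.1 hn with hn | hn
    · exact Finset.mem_union_left _ (Finset.mem_sdiff.1 hn).1
    · exact Finset.mem_union_right _ hn
  have hy' : ((X ++ (f 0, f 1) :: bs ++ Y).map fun p => (ofComb _ _ hcd).label p.2)
      = (u ++ [a]).map Sum.inr ++ (Bs ++ γ).map Sum.inl := by
    have k₁ : ∀ p ∈ X ++ (q', q') :: Y, lab p.2 = Γ.label p.2 := fun p hp =>
      hlab₁ _ (h.isComb.snd_mem hp)
    have k₂ : ∀ p ∈ (f 0, f 1) :: bs, lab p.2 = Γ₂.label p.2 := fun p hp =>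
      hlab₂ _ (h₂.snd_mem hp)
    change ((X ++ (f 0, f 1) :: bs ++ Y).map fun p => lab p.2) = _
    rw [List.map_append, List.map_append, List.map_congr_left k₂,
      List.map_congr_left fun p hp => k₁ p (by simp [hp]), hyX,
      List.map_congr_left fun p (hp : p ∈ Y) => k₁ p (by simp [hp]), hyY,
      List.map_cons, hlbs, hla]
    simp
  refine ⟨ofComb _ _ hcd, _, ⟨a, rfl, ⟨_, ⟨_, hρ, rfl⟩, f, Γ₂, q', hf, hlab, hI⟩, u, ?_, ?_⟩,
    h₃, hy'⟩
  · exact (h.isComb.isSymbolYield_iff h.yield u).2 rfl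
  · exact (h₃.isSymbolYield_iff hy' _).2 rfl

/-- Computations of the grammar that end in a graph without variables in its yield are runs of the
system. -/
theorem run_of_reflTransGen {Γ Γf : ParseGraph V α} {P : List (ℕ × ℕ)} {u w : List α}
    {γ : List V} (h : Represents Γ P u γ)
    (hs : Relation.ReflTransGen (toGrammar S R hR).Step (Γ, w) (Γf, [])) {x : List α}
    (hy : Γf.IsYield (x.map Sum.inr)) : Run R γ w := by
  generalize hI : ((Γ, w) : (toGrammar S R hR).ID) = I at hs
  induction hs using Relation.ReflTransGen.head_induction_on generalizing Γ P u w γ with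
  | refl =>
    obtain ⟨rfl, rfl⟩ := Prod.mk.inj hI
    have hy := (h.isComb.isYield_iff _).1 hy
    rw [h.yield] at hy
    cases γ with
    | nil => exact .nil
    | cons A γ =>
      have : (Sum.inl A : V ⊕ α) ∈ x.map Sum.inr := by rw [hy]; simp
      simp at this
  | @head I J hstep _ ih =>
    subst hI
    obtain ⟨A, a, Bs, γ, P', rfl, rfl, hρ, h'⟩ := h.exists_of_step (V := V) (Γ' := J.1) (w' := J.2) hstep
    exact .cons hρ (ih h' rfl)

theorem exists_reflTransGen_of_run {γ : List V} {w : List α} (hr : Run R γ w)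
    {Γ : ParseGraph V α} {P : List (ℕ × ℕ)} {u : List α} (h : Represents Γ P u γ) :
    ∃ Γf, Relation.ReflTransGen (toGrammar S R hR).Step (Γ, w) (Γf, []) ∧
      Γf.IsYield ((u ++ w).map Sum.inr) := by
  induction hr generalizing Γ P u with
  | nil =>
    refine ⟨Γ, .refl, (h.isComb.isYield_iff _).2 ?_⟩
    have hy := h.yield
    rw [List.map_nil, List.append_nil] at hy
    rw [List.append_nil]
    exact hy.symm
  | cons hρ _ ih =>
    obtain ⟨Γ', P', hs, h'⟩ := h.exists_step (S := S) (hR := hR) hρ _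
    obtain ⟨Γf, hs', hy⟩ := ih h'
    exact ⟨Γf, .head hs hs', by simpa using hy⟩

theorem mem_language_toGrammar_iff (w : List α) :
    w ∈ (toGrammar S R hR).language ↔ Run R [S] w := by
  have hstart : ∀ Γ : ParseGraph V α, Γ.IsSingle S → Represents Γ [(Γ.root, Γ.root)] [] [S] :=
    fun Γ hΓ => ⟨.of_isSingle hΓ, by simp [hΓ.2.2]⟩
  constructor
  · rintro ⟨Γ₀, Γf, h₀, hs, hy⟩
    exact run_of_reflTransGen (hstart Γ₀ h₀) hs hy
  · intro hr
    have hd : IsCombData (fun _ => (Sum.inl S : V ⊕ α)) [(0, 0)] := by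
      constructor <;> simp
    have h₀ : (ofComb _ _ hd).IsSingle S := ⟨by simp [ofComb], by simp [ofComb], rfl⟩
    obtain ⟨Γf, hs, hy⟩ := exists_reflTransGen_of_run (S := S) (hR := hR) hr (hstart _ h₀)
    exact ⟨_, Γf, h₀, hs, by simpa using hy⟩

end

end Greibach

theorem theorem2 {α : Type*} (L : Language α) (hL : L.IsContextFree)
    (hε : ([] : List α) ∉ L) :
    ∃ G : GraphInterpolationGrammar α, G.language = L := by
  obtain ⟨g, rfl⟩ := hL
  obtain ⟨n, S, R, hR, hrun⟩ := Greibach.exists_run_iff g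
  refine ⟨Greibach.toGrammar S R hR, Set.ext fun w => ?_⟩
  refine (Greibach.mem_language_toGrammar_iff w).trans ((hrun w).trans (and_iff_left_of_imp ?_))
  rintro hw rfl
  exact hε hw
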